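/- Work over $\mathbb{C}$. Let $n \ge 3$ and $k\ge 0$ be integers, and let $\alpha_{ij}\in\mathbb{N}$ ($1\le i\le n$, $0\le j\le k$) be tangency orders such that $\sum_i \alpha_{ij} = d$ for every $j$, with $d$ independent of $j$, and such that for every $i$ there is some $j$ with $\alpha_{ij}=0$. Let $\mathcal{M}=\mathcal{M}_{0,\alpha}(\mathbb{P}^k,\partial\mathbb{P}^k)$ be the space of maps $f\colon (C,p_1,\dots,p_n)\to\mathbb{P}^k$ from smooth rational curves with $n$ distinct marked points that meet the coordinate hyperplanes $H_0,\dots,H_k$ only at the marked points, $p_i$ having contact order $\alpha_{ij}$ with $H_j$. Let $\mathrm{ev}_i\colon\mathcal{M}\to\mathbb{P}^k$, $f\mapsto f(p_i)$. Fix $i_0\in\{4,\dots,n\}$ with $\alpha_{i_0j}=0$ for all $j$. Normalise $C=\mathbb{P}^1$, $p_1=[0:1]$, $p_2=[1:1]$, $p_3=[1:0]$, and write $p_u=[S_u:T_u]$. Regard $\mathcal{M}$ as a subset of $\mathbb{P}^{n-3}\times\mathbb{P}^k$ through $$f\longmapsto\big([1:S_4/T_4:\cdots:S_n/T_n],\ f(p_{i_0})\big).$$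 Let $H_1,H_2\in A_{n+k-4}(\mathbb{P}^{n-3}\times\mathbb{P}^k)$ denote the classes pulled back from a hyperplane of $\mathbb{P}^{n-3}$ and of $\mathbb{P}^k$, respectively. **Proposition 3.4.** Let $i\ne i_0$ be a marking with $\alpha_{ij}=0$ for at least two values of $j$ (that is, $p_i$ is not forced to map to a torus-fixed point). Then there is an integer $\chi$ with $$\chi\le\sum_{u=1}^n\max_j\alpha_{uj}$$ such that, for every hyperplane $H$ in a nonempty Zariski-open subset of the dual projective space of $\mathbb{P}^k$, the Zariski closure $\overline{\mathrm{ev}_i^{-1}(H)}\subset\mathbb{P}^{n-3}\times\mathbb{P}^k$ has pure codimension one and its class (with reduced structure) is $$[\overline{\mathrm{ev}_i^{-1}(H)}]=\chi H_1+H_2 .$$ -/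

import Mathlib

open MvPolynomial
open scoped LinearAlgebra.Projectivization

namespace TangencyBound

noncomputable section

/-! ### Products of projective spaces and their divisor classes -/

/-- Complex projective space of dimension `r`, as the set of its closed points. -/
abbrev ProjSpace (r : ℕ) : Type := ℙ ℂ (Fin (r + 1) → ℂ)

/-- The closed points of the product of projective spaces `ℙ^m × ℙ^k`. It is a separate type
because it carries the Zariski topology of the product variety. -/
def BiProj (m k : ℕ) : Type := ProjSpace m × ProjSpace k

/-- The bihomogeneous coordinate ring of `ℙ^m × ℙ^k`: polynomials in the coordinates
`X_0, …, X_m` (left) of the first factor and `A_0, …, A_k` (right) of the second factor. -/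
abbrev BiPoly (m k : ℕ) : Type := MvPolynomial (Fin (m + 1) ⊕ Fin (k + 1)) ℂ

variable {m k : ℕ}

/-- `F` is bihomogeneous of bidegree `(a, b)`: every monomial of `F` has degree `a` in the
coordinates of the first factor and degree `b` in the coordinates of the second factor. -/
def IsBihomogeneous (F : BiPoly m k) (a b : ℕ) : Prop :=
  IsWeightedHomogeneous
    (Sum.elim (fun _ => (1, 0)) (fun _ => (0, 1)) : Fin (m + 1) ⊕ Fin (k + 1) → ℕ × ℕ) F (a, b)

/-- The zero locus in `ℙ^m × ℙ^k` of a polynomial (meaningful for bihomogeneous ones, whose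
vanishing does not depend on the representatives). -/
def zeroLocus (F : BiPoly m k) : Set (BiProj m k) :=
  {z | eval (Sum.elim z.1.rep z.2.rep) F = 0}

/-- The Zariski topology of `ℙ^m × ℙ^k`, generated by the complements of the zero loci of
bihomogeneous polynomials. -/
instance : TopologicalSpace (BiProj m k) :=
  TopologicalSpace.generateFrom {U | ∃ F a b, IsBihomogeneous F a b ∧ U = (zeroLocus F)ᶜ}

/-- The ideal of a subset of `ℙ^m × ℙ^k` in the bihomogeneous coordinate ring. -/
def vanishingIdeal (Z : Set (BiProj m k)) : Ideal (BiPoly m k) :=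
  Ideal.span {F | (∃ a b, IsBihomogeneous F a b) ∧ Z ⊆ zeroLocus F}

/-- A prime divisor of `ℙ^m × ℙ^k`: an irreducible closed subset of codimension one. -/
abbrev PrimeDivisor (m k : ℕ) : Type :=
  {Z : TopologicalSpace.IrreducibleCloseds (BiProj m k) // Order.coheight Z = 1}

/-- The order of vanishing of a nonzero bihomogeneous polynomial along a prime divisor: the
largest `r` such that it lies in the `r`-th power of the ideal of the divisor. (The coordinate
ring is factorial, so this ideal is generated by one irreducible polynomial `G` and the order is
the exponent of `G` in `F`.) -/
def ordAlong (Z : PrimeDivisor m k) (F : BiPoly m k) : ℕ :=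
  sSup {r | F ∈ vanishingIdeal (Z.1 : Set (BiProj m k)) ^ r}

/-- Divisors, that is algebraic cycles of dimension `m + k - 1`, on `ℙ^m × ℙ^k`. -/
abbrev Divisor (m k : ℕ) : Type := PrimeDivisor m k →₀ ℤ

/-- The group of divisors that are rationally equivalent to zero, generated by the divisors of
the nonzero rational functions `F / G`, with `F` and `G` bihomogeneous of the same bidegree. -/
def rationallyTrivial (m k : ℕ) : AddSubgroup (Divisor m k) :=
  AddSubgroup.closure
    {D | ∃ (F G : BiPoly m k) (a b : ℕ), F ≠ 0 ∧ G ≠ 0 ∧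
      IsBihomogeneous F a b ∧ IsBihomogeneous G a b ∧
      ∀ Z, D Z = (ordAlong Z F : ℤ) - (ordAlong Z G : ℤ)}

/-- The Chow group `A_{m+k-1}(ℙ^m × ℙ^k)`: divisors modulo rational equivalence. -/
abbrev DivisorClassGroup (m k : ℕ) : Type := Divisor m k ⧸ rationallyTrivial m k

/-- The irreducible components of a subset `Z` of `ℙ^m × ℙ^k`. -/
def components (Z : Set (BiProj m k)) : Set (Set (BiProj m k)) :=
  {Y | Maximal (fun W => IsIrreducible W ∧ W ⊆ Z) Y}

/-- `Z` is closed, and all its irreducible components are prime divisors. -/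
def IsDivisorial (Z : Set (BiProj m k)) : Prop :=
  IsClosed Z ∧ ∀ Y ∈ components Z, ∃ D : PrimeDivisor m k, (D.1 : Set (BiProj m k)) = Y

/-- The class of a divisorial closed subset (with its reduced structure): the sum of its
irreducible components, modulo rational equivalence. -/
def divisorClass (Z : Set (BiProj m k)) : DivisorClassGroup m k :=
  QuotientAddGroup.mk
    (∑ᶠ D ∈ {D : PrimeDivisor m k | (D.1 : Set (BiProj m k)) ∈ components Z}, Finsupp.single D 1)

/-- The class `H_1`, pulled back from a hyperplane of the first factor. -/
def classH1 (m k : ℕ) : DivisorClassGroup m k := divisorClass (zeroLocus (X (Sum.inl 0)))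

/-- The class `H_2`, pulled back from a hyperplane of the second factor. -/
def classH2 (m k : ℕ) : DivisorClassGroup m k := divisorClass (zeroLocus (X (Sum.inr 0)))

/-! ### Maps from marked rational curves to projective space with tangency conditions -/

/-- The point `[s : t]` of the projective line. -/
def linePoint (s t : ℂ) (h : ![s, t] ≠ 0) : ProjSpace 1 := Projectivization.mk ℂ ![s, t] h

/-- The order of vanishing of a binary form `F` at the point `q = [S : T]` of the projective
line: the multiplicity in `F` of the linear form `T X - S Y` that vanishes at `q`. -/
def contactOrder (F : MvPolynomial (Fin 2) ℂ) (q : ProjSpace 1) : ℕ∞ :=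
  emultiplicity (C (q.rep 1) * X 0 - C (q.rep 0) * X 1) F

/-- A point of `M_{0,α}(ℙ^k, ∂ℙ^k)`, with `m + 3` markings: a morphism from a smooth rational
curve with distinct marked points to `ℙ^k` that meets the coordinate hyperplanes precisely at the
marked points, the `i`-th marking having contact order `α i j` with the `j`-th hyperplane.
Every isomorphism class of such maps is represented on the projective line with the first three
markings at `[0 : 1]`, `[1 : 1]`, `[1 : 0]`, in a unique way up to a common factor of the forms
that define the morphism. -/
structure LogMap (α : Fin (m + 3) → Fin (k + 1) → ℕ) where
  marking : Fin (m + 3) → ProjSpace 1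
  marking_injective : Function.Injective marking
  marking_zero : marking 0 = linePoint 0 1 (by simp)
  marking_one : marking 1 = linePoint 1 1 (by simp)
  marking_two : marking 2 = linePoint 1 0 (by simp)
  degree : ℕ
  form : Fin (k + 1) → MvPolynomial (Fin 2) ℂ
  form_homogeneous : ∀ j, (form j).IsHomogeneous degree
  base_point_free : ∀ q : ProjSpace 1, ∃ j, eval q.rep (form j) ≠ 0
  contact : ∀ i j, contactOrder (form j) (marking i) = (α i j : ℕ∞)
  boundary : ∀ (q : ProjSpace 1) (j : Fin (k + 1)), eval q.rep (form j) = 0 →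
    q ∈ Set.range marking

namespace LogMap

variable {α : Fin (m + 3) → Fin (k + 1) → ℕ}

/-- The morphism from the projective line to `ℙ^k`. -/
def toFun (f : LogMap α) (q : ProjSpace 1) : ProjSpace k :=
  Projectivization.mk ℂ (fun j => eval q.rep (f.form j)) (by
    obtain ⟨j, hj⟩ := f.base_point_free q
    exact fun h => hj (congrFun h j))

/-- The evaluation map at the `i`-th marking. -/
def ev (i : Fin (m + 3)) (f : LogMap α) : ProjSpace k := f.toFun (f.marking i)

/-- The source curve as a point of `M_{0,m+3} ⊆ 𝔸^m ⊆ ℙ^m`, namely `[1 : S_4/T_4 : ⋯ : S_n/T_n]`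
where `[S_u : T_u]` is the `u`-th marking and `n = m + 3`. The denominators are nonzero as only
the third marking is `[1 : 0]`. -/
def fgt (f : LogMap α) : ProjSpace m :=
  Projectivization.mk ℂ
    (Fin.cons 1 fun u : Fin m =>
      (f.marking (u.addNat 3)).rep 0 / (f.marking (u.addNat 3)).rep 1 : Fin (m + 1) → ℂ)
    (fun h => one_ne_zero (congrFun h 0))

/-- The embedding `fgt × ev_{i₀}` of `M_{0,α}(ℙ^k, ∂ℙ^k)` into `ℙ^m × ℙ^k`. -/
def embed (i₀ : Fin (m + 3)) (f : LogMap α) : BiProj m k := (f.fgt, f.ev i₀)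

end LogMap

/-- The hyperplane `μ_0 B_0 + ⋯ + μ_k B_k = 0` of `ℙ^k`. -/
def hyperplane (μ : Fin (k + 1) → ℂ) : Set (ProjSpace k) := {b | ∑ j, μ j * b.rep j = 0}

/-- The subset `ev_i⁻¹(H)` of `M_{0,α}(ℙ^k, ∂ℙ^k)`, viewed in `ℙ^m × ℙ^k` by `fgt × ev_{i₀}`. -/
def evPreimage (α : Fin (m + 3) → Fin (k + 1) → ℕ) (i₀ i : Fin (m + 3))
    (H : Set (ProjSpace k)) : Set (BiProj m k) :=
  LogMap.embed i₀ '' {f : LogMap α | f.ev i ∈ H}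

end

end TangencyBound

open TangencyBound

/-! A map in the moduli space is determined by its markings and nonzero scalars `c j`: its `j`-th
form must be `c j` times the product over `u` of the linear form vanishing at marking `u`, to the
power `α u j` (`LogMap.exists_form_eq`). Since `i₀` has no tangency, its value `y` has all
coordinates nonzero, and `c` is recovered from `y`. Hence the embedding identifies the moduli space
with the open set where the markings are distinct and finite (apart from `[1 : 0]`) and no
coordinate of the second factor vanishes: the complement of the zero locus of `boundaryForm`.

The value at `i` has zero `j`-th coordinate when `α i j ≠ 0`. For the remaining `j`, gathered in
`J`, it is `y j` times a quotient of products of collision forms. Multiplying by a factor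
independent of `j` turns these quotients into forms `transferForm j`, all of degree the sum of
`max_j α u j` over the markings `u` other than `i`, `i₀` and `[1 : 0]`. So on the open set the
preimage of the hyperplane has equation `∑ μ_j A_j P_j(X) = 0`, with `P_j` the transfer forms.

The common factor of the `P_j` is nonzero on the open set and can be removed, which only lowers the
degree, to some `e`. What remains has bidegree `(e, 1)`, is linear in `A`, and has coprime
coefficients, so it is prime (`prime_linearForm`). Its zero locus is irreducible and, because `J`
has two elements, meets the open set; it is therefore the closure sought. A prime form of bidegree
`(e, 1)` has class `e H_1 + H_2` (`divisorClass_zeroLocus_eq`), so `χ = e`. -/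

namespace TangencyBound

/-! ### Weighted homogeneous polynomials -/

section WeightedHomogeneous

variable {σ M : Type*} {w : σ → M}

theorem weightedHomogeneousComponent_mul_of_left [AddCancelCommMonoid M] {F G : MvPolynomial σ ℂ}
    {b : M} (hF : IsWeightedHomogeneous w F b) (n : M) :
    weightedHomogeneousComponent w (b + n) (F * G) = F * weightedHomogeneousComponent w n G := by
  classical
  let := weightedGradedAlgebra ℂ w
  have key : ∀ (P : MvPolynomial σ ℂ) (p : M),
      (DirectSum.decompose (weightedHomogeneousSubmodule ℂ w) P p : MvPolynomial σ ℂ) =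
        weightedHomogeneousComponent w p P := fun P p =>
    weightedDecomposition.decompose'_apply ℂ w P p
  rw [← key, ← key]
  exact DirectSum.coe_decompose_mul_add_of_left_mem (weightedHomogeneousSubmodule ℂ w) hF

/-- A factor of a weighted homogeneous polynomial is weighted homogeneous if the complementary
factor is. -/
theorem exists_isWeightedHomogeneous_of_mul [AddCancelCommMonoid M] {F G : MvPolynomial σ ℂ}
    {a b : M} (hF : IsWeightedHomogeneous w F b) (hF0 : F ≠ 0) (hG0 : G ≠ 0)
    (hFG : IsWeightedHomogeneous w (F * G) a) : ∃ n, b + n = a ∧ IsWeightedHomogeneous w G n := by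
  classical
  -- The component of `F * G` in weight `b + n` is `F` times the component of `G` in weight `n`. If
  -- it vanishes, so does that component of `G`, since `F ≠ 0`.
  have key : ∀ d, coeff d G ≠ 0 → b + Finsupp.weight w d = a := by
    intro d hd
    by_contra hne
    have h0 := hFG.weightedHomogeneousComponent_ne _ hne
    rw [weightedHomogeneousComponent_mul_of_left hF] at h0
    have h1 := (mul_eq_zero.1 h0).resolve_left hF0
    have h2 := congrArg (coeff d) h1
    rw [coeff_weightedHomogeneousComponent, if_pos rfl, coeff_zero] at h2
    exact hd h2
  obtain ⟨d, hd⟩ := ne_zero_iff.1 hG0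
  refine ⟨_, key d hd, fun d' hd' => ?_⟩
  exact add_left_cancel ((key d' hd').trans (key d hd).symm)

/-- A character of the grading monoid covers at once the scaling of one vector (grading by `ℕ`) and
the independent scaling of two vectors (grading by `ℕ × ℕ`). -/
theorem eval_smul_of_isWeightedHomogeneous [AddCommMonoid M] {F : MvPolynomial σ ℂ} {a : M}
    (hF : IsWeightedHomogeneous w F a) (χ : Multiplicative M →* ℂ) (x : σ → ℂ) :
    eval (fun i => χ (.ofAdd (w i)) * x i) F = χ (.ofAdd a) * eval x F := by
  rw [eval_eq, eval_eq, Finset.mul_sum]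
  refine Finset.sum_congr rfl fun d hd => ?_
  have h : χ (.ofAdd a) = ∏ i ∈ d.support, χ (.ofAdd (w i)) ^ d i := by
    rw [← hF (mem_support_iff.1 hd), Finsupp.weight_apply, Finsupp.sum, ofAdd_sum, map_prod]
    refine Finset.prod_congr rfl fun i _ => ?_
    rw [ofAdd_nsmul, map_pow]
  rw [h]
  simp_rw [mul_pow, Finset.prod_mul_distrib]
  ring

end WeightedHomogeneous

theorem eval_smul_of_isHomogeneous {σ : Type*} {F : MvPolynomial σ ℂ} {n : ℕ}
    (hF : F.IsHomogeneous n) (c : ℂ) (x : σ → ℂ) : eval (c • x) F = c ^ n * eval x F := by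
  have h := eval_smul_of_isWeightedHomogeneous hF (powersHom ℂ c) x
  simpa [powersHom_apply, Pi.smul_def] using h

variable {m k : ℕ}

/-! ### Bihomogeneous forms -/

namespace IsBihomogeneous

variable {F G : BiPoly m k} {a b a' b' : ℕ}

theorem eval_smul (hF : IsBihomogeneous F a b) (s t : ℂ) (x : Fin (m + 1) → ℂ)
    (y : Fin (k + 1) → ℂ) :
    eval (Sum.elim (s • x) (t • y)) F = s ^ a * t ^ b * eval (Sum.elim x y) F := by
  have h := eval_smul_of_isWeightedHomogeneous hF
    ({ toFun := fun p => s ^ p.toAdd.1 * t ^ p.toAdd.2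
       map_one' := by simp
       map_mul' := fun p q => by simp [pow_add]; ring } : Multiplicative (ℕ × ℕ) →* ℂ)
    (Sum.elim x y)
  rw [← show (fun i => _) = Sum.elim (s • x) (t • y) from ?_, h]
  · simp
  · ext (i | i) <;> simp

theorem mul (hF : IsBihomogeneous F a b) (hG : IsBihomogeneous G a' b') :
    IsBihomogeneous (F * G) (a + a') (b + b') :=
  IsWeightedHomogeneous.mul hF hG

theorem pow (hF : IsBihomogeneous F a b) (n : ℕ) : IsBihomogeneous (F ^ n) (n * a) (n * b) := by
  have h := IsWeightedHomogeneous.pow hF n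
  rwa [Prod.smul_mk, smul_eq_mul, smul_eq_mul] at h

theorem exists_of_mul (hF : IsBihomogeneous F a b) (hF0 : F ≠ 0) (hG0 : G ≠ 0)
    (hFG : IsBihomogeneous (F * G) a' b') : ∃ c d, IsBihomogeneous G c d := by
  obtain ⟨n, -, hn⟩ := exists_isWeightedHomogeneous_of_mul hF hF0 hG0 hFG
  exact ⟨n.1, n.2, hn⟩

end IsBihomogeneous

theorem isBihomogeneous_one : IsBihomogeneous (1 : BiPoly m k) 0 0 :=
  isWeightedHomogeneous_one ℂ _

theorem isBihomogeneous_inl (u : Fin (m + 1)) :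
    IsBihomogeneous (X (Sum.inl u) : BiPoly m k) 1 0 :=
  isWeightedHomogeneous_X ℂ _ _

theorem isBihomogeneous_inr (j : Fin (k + 1)) :
    IsBihomogeneous (X (Sum.inr j) : BiPoly m k) 0 1 :=
  isWeightedHomogeneous_X ℂ _ _

/-! ### Zero loci -/

/-- The point of `ℙ^m × ℙ^k` with the given homogeneous coordinates. -/
noncomputable def biPoint (x : Fin (m + 1) → ℂ) (y : Fin (k + 1) → ℂ) (hx : x ≠ 0) (hy : y ≠ 0) : BiProj m k :=
  (Projectivization.mk ℂ x hx, Projectivization.mk ℂ y hy)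

theorem biPoint_mem_zeroLocus {F : BiPoly m k} {a b : ℕ} (hF : IsBihomogeneous F a b)
    {x : Fin (m + 1) → ℂ} (hx : x ≠ 0) {y : Fin (k + 1) → ℂ} (hy : y ≠ 0) :
    biPoint x y hx hy ∈ zeroLocus F ↔
      eval (Sum.elim x y) F = 0 := by
  obtain ⟨s, hs⟩ := Projectivization.exists_smul_eq_mk_rep ℂ x hx
  obtain ⟨t, ht⟩ := Projectivization.exists_smul_eq_mk_rep ℂ y hy
  have hs' : (s : ℂ) ≠ 0 := s.ne_zero
  have ht' : (t : ℂ) ≠ 0 := t.ne_zero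
  change eval (Sum.elim (Projectivization.mk ℂ x hx).rep (Projectivization.mk ℂ y hy).rep) F = 0 ↔ _
  rw [← hs, ← ht, Units.smul_def, Units.smul_def, hF.eval_smul]
  simp [hs', ht']

theorem zeroLocus_mul (F G : BiPoly m k) : zeroLocus (F * G) = zeroLocus F ∪ zeroLocus G := by
  ext z
  simp [zeroLocus]

theorem isClosed_zeroLocus {F : BiPoly m k} {a b : ℕ} (hF : IsBihomogeneous F a b) :
    IsClosed (zeroLocus F) :=
  isOpen_compl_iff.1 (TopologicalSpace.isOpen_generateFrom_of_mem ⟨F, a, b, hF, rfl⟩)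

theorem isTopologicalBasis_zeroLocus_compl :
    TopologicalSpace.IsTopologicalBasis
      {U : Set (BiProj m k) | ∃ F a b, IsBihomogeneous F a b ∧ U = (zeroLocus F)ᶜ} := by
  refine ⟨?_, ?_, rfl⟩
  · rintro _ ⟨F, a, b, hF, rfl⟩ _ ⟨G, a', b', hG, rfl⟩ z hz
    refine ⟨_, ⟨F * G, _, _, hF.mul hG, rfl⟩, ?_, ?_⟩
    · rw [zeroLocus_mul, Set.compl_union]; exact hz
    · rw [zeroLocus_mul, Set.compl_union]
  · refine Set.eq_univ_of_forall fun z => ?_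
    exact ⟨_, ⟨1, 0, 0, isBihomogeneous_one, rfl⟩, by simp [zeroLocus]⟩

/-- The projective Nullstellensatz for a prime bihomogeneous form. -/
theorem dvd_of_zeroLocus_subset (hm : 1 ≤ m) (hk : 1 ≤ k) {F G : BiPoly m k} {a b a' b' : ℕ}
    (hG : IsBihomogeneous G a' b') (hGp : Prime G)
    (hF : IsBihomogeneous F a b) (h : zeroLocus G ⊆ zeroLocus F) : G ∣ F := by
  -- The affine Nullstellensatz applies to this product: an affine zero of `G` either defines a
  -- point of the biprojective space, where `F` vanishes, or has a zero block of coordinates, which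
  -- kills one of the two variables.
  have key : ∀ u j, G ∣ F * (X (Sum.inl u) * X (Sum.inr j)) := by
    intro u j
    have : (Ideal.span {G}).IsPrime := (Ideal.span_singleton_prime hGp.ne_zero).2 hGp
    rw [← Ideal.mem_span_singleton, ← MvPolynomial.IsPrime.vanishingIdeal_zeroLocus (K := ℂ)
      (Ideal.span {G}), MvPolynomial.mem_vanishingIdeal_iff]
    intro z hz
    rw [MvPolynomial.zeroLocus_span] at hz
    have hz0 : eval z G = 0 := by simpa [aeval_eq_eval] using hz
    simp only [aeval_eq_eval, map_mul, eval_X]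
    by_contra hne
    have hx : (z ∘ Sum.inl) ≠ 0 := fun h0 => hne (by
      rw [show z (Sum.inl u) = 0 from congrFun h0 u]; ring)
    have hy : (z ∘ Sum.inr) ≠ 0 := fun h0 => hne (by
      rw [show z (Sum.inr j) = 0 from congrFun h0 j]; ring)
    have hz' : Sum.elim (z ∘ Sum.inl) (z ∘ Sum.inr) = z := Sum.elim_comp_inl_inr z
    have h1 := h ((biPoint_mem_zeroLocus hG hx hy).2 (by rw [hz', hz0]))
    rw [biPoint_mem_zeroLocus hF hx hy, hz'] at h1
    exact hne (by rw [h1]; ring)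
  by_contra hnd
  have h2 : ∀ u j, G ∣ X (Sum.inl u) ∨ G ∣ X (Sum.inr j) := fun u j =>
    hGp.dvd_or_dvd ((hGp.dvd_or_dvd (key u j)).resolve_left hnd)
  -- A prime divides at most one variable. As each block has at least two variables, some pair `(u,
  -- j)` then avoids both alternatives of `h2`.
  have h3 : ∀ p q : Fin (m + 1) ⊕ Fin (k + 1), p ≠ q → G ∣ X p → G ∣ X q → False := by
    intro p q hpq hp hq
    have hpa := (hGp.irreducible.dvd_irreducible_iff_associated
      (X_prime (R := ℂ) (i := p)).irreducible).1 hp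
    have h4 := hpa.dvd_iff_dvd_left.1 hq
    exact hpq (X_dvd_X.1 h4)
  have hm' : Fin.last m ≠ 0 := fun h => by simp [Fin.ext_iff] at h; omega
  have hk' : Fin.last k ≠ 0 := fun h => by simp [Fin.ext_iff] at h; omega
  rcases h2 0 0 with h0 | h0
  · rcases h2 (Fin.last m) 0 with h1 | h1
    · exact h3 _ _ (by simpa using hm') h1 h0
    · exact h3 _ _ (by simp) h1 h0
  · rcases h2 0 (Fin.last k) with h1 | h1
    · exact h3 _ _ (by simp) h1 h0
    · exact h3 _ _ (by simpa using hk') h1 h0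

theorem zeroLocus_ne_univ {F : BiPoly m k} {a b : ℕ} (hF : IsBihomogeneous F a b) (hF0 : F ≠ 0) :
    zeroLocus F ≠ Set.univ := by
  intro h
  have hne : F * (X (Sum.inl 0) * X (Sum.inr 0)) ≠ 0 :=
    mul_ne_zero hF0 (mul_ne_zero (X_ne_zero _) (X_ne_zero _))
  refine hne (MvPolynomial.funext fun z => ?_)
  by_contra hz
  have hx : (z ∘ Sum.inl) ≠ 0 := fun h0 => hz (by
    simp [show z (Sum.inl 0) = 0 from congrFun h0 0])
  have hy : (z ∘ Sum.inr) ≠ 0 := fun h0 => hz (by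
    simp [show z (Sum.inr 0) = 0 from congrFun h0 0])
  have h1 : biPoint _ _ hx hy ∈ zeroLocus F := h ▸ Set.mem_univ _
  rw [biPoint_mem_zeroLocus hF, Sum.elim_comp_inl_inr] at h1
  exact hz (by simp [h1])

/-- Irreducibility can be tested on basic open sets, that is, on complements of zero loci of single
forms. -/
theorem isPreirreducible_of_forall_zeroLocus {Z : Set (BiProj m k)}
    (h : ∀ (F G : BiPoly m k) (a b a' b' : ℕ), IsBihomogeneous F a b → IsBihomogeneous G a' b' →
      Z ⊆ zeroLocus (F * G) → Z ⊆ zeroLocus F ∨ Z ⊆ zeroLocus G) : IsPreirreducible Z := by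
  rintro U V hU hV ⟨x, hxZ, hxU⟩ ⟨y, hyZ, hyV⟩
  obtain ⟨_, ⟨F, a, b, hF, rfl⟩, hxF, hFU⟩ :=
    isTopologicalBasis_zeroLocus_compl.exists_subset_of_mem_open hxU hU
  obtain ⟨_, ⟨G, a', b', hG, rfl⟩, hyG, hGV⟩ :=
    isTopologicalBasis_zeroLocus_compl.exists_subset_of_mem_open hyV hV
  by_contra hne
  have h0 : Z ⊆ zeroLocus (F * G) := by
    intro z hz
    by_contra hzn
    rw [zeroLocus_mul] at hzn
    exact hne ⟨z, hz, hFU fun h' => hzn (Or.inl h'), hGV fun h' => hzn (Or.inr h')⟩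
  rcases h F G a b a' b' hF hG h0 with h1 | h1
  · exact hxF (h1 hxZ)
  · exact hyG (h1 hyZ)

theorem isIrreducible_univ_biProj : IsIrreducible (Set.univ : Set (BiProj m k)) := by
  have hone : ∀ r : ℕ, (1 : Fin (r + 1) → ℂ) ≠ 0 := fun r h => one_ne_zero (congrFun h 0)
  refine ⟨⟨biPoint 1 1 (hone m) (hone k), trivial⟩,
    isPreirreducible_of_forall_zeroLocus fun F G a b a' b' hF hG h => ?_⟩
  have h0 : F * G = 0 := by
    by_contra hne
    exact zeroLocus_ne_univ (hF.mul hG) hne (Set.univ_subset_iff.1 h)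
  rcases mul_eq_zero.1 h0 with rfl | rfl
  · exact Or.inl fun z _ => by simp [zeroLocus]
  · exact Or.inr fun z _ => by simp [zeroLocus]

theorem zeroLocus_subset_of_dvd {F G : BiPoly m k} (h : G ∣ F) : zeroLocus G ⊆ zeroLocus F := by
  obtain ⟨H, rfl⟩ := h
  rw [zeroLocus_mul]
  exact Set.subset_union_left

/-! ### Prime forms, their prime divisors and divisor classes -/

section Prime

variable {G : BiPoly m k} {a b : ℕ}

theorem isIrreducible_zeroLocus (hm : 1 ≤ m) (hk : 1 ≤ k) (hG : IsBihomogeneous G a b)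
    (hGp : Prime G) : IsIrreducible (zeroLocus G) := by
  refine ⟨?_, isPreirreducible_of_forall_zeroLocus fun F F' _ _ _ _ hF hF' h => ?_⟩
  · rw [Set.nonempty_iff_ne_empty]
    intro h0
    exact hGp.not_isUnit (isUnit_of_dvd_one
      (dvd_of_zeroLocus_subset hm hk hG hGp isBihomogeneous_one (h0 ▸ Set.empty_subset _)))
  · exact (hGp.dvd_or_dvd (dvd_of_zeroLocus_subset hm hk hG hGp (hF.mul hF') h)).imp
      zeroLocus_subset_of_dvd zeroLocus_subset_of_dvd

/-- The zero locus of a prime bihomogeneous form is maximal among the proper irreducible closed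
subsets. -/
theorem eq_univ_of_zeroLocus_ssubset (hm : 1 ≤ m) (hk : 1 ≤ k) (hG : IsBihomogeneous G a b)
    (hGp : Prime G) {W : Set (BiProj m k)} (hW : IsIrreducible W) (hWc : IsClosed W)
    (h : zeroLocus G ⊂ W) : W = Set.univ := by
  by_contra hne
  obtain ⟨z, hz⟩ := (Set.ne_univ_iff_exists_notMem W).1 hne
  obtain ⟨_, ⟨F, c, d, hF, rfl⟩, hzF, hFW⟩ :=
    isTopologicalBasis_zeroLocus_compl.exists_subset_of_mem_open hz hWc.isOpen_compl
  have hWF : W ⊆ zeroLocus F := Set.compl_subset_compl.1 hFW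
  have hF0 : F ≠ 0 := by rintro rfl; exact hzF (by simp [zeroLocus])
  -- With `F = G ^ r * H`, irreducibility puts `W` inside the zero locus of `G` or of `H`. The first
  -- contradicts strictness of the inclusion; the second makes `G` divide `H`.
  obtain ⟨H, hFH, hnd⟩ := (FiniteMultiplicity.of_prime_left hGp hF0).exists_eq_pow_mul_and_not_dvd
  set r := multiplicity G F
  have hH0 : H ≠ 0 := by rintro rfl; exact hnd (dvd_zero _)
  obtain ⟨c', d', hH⟩ := (hG.pow r).exists_of_mul (pow_ne_zero _ hGp.ne_zero) hH0 (hFH ▸ hF)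
  have hWGH : W ⊆ zeroLocus G ∪ zeroLocus H := by
    intro z hz
    have h1 := hWF hz
    rw [hFH, zeroLocus_mul] at h1
    refine h1.imp_left fun h2 => ?_
    simp only [zeroLocus, Set.mem_ofPred_eq, map_pow] at h2
    exact eq_zero_of_pow_eq_zero h2
  rcases isPreirreducible_iff_isClosed_union_isClosed.1 hW.2 _ _ (isClosed_zeroLocus hG)
    (isClosed_zeroLocus hH) hWGH with h1 | h1
  · exact h.not_subset h1
  · exact hnd (dvd_of_zeroLocus_subset hm hk hG hGp hH (h.subset.trans h1))

theorem components_of_isIrreducible {Z : Set (BiProj m k)} (hZ : IsIrreducible Z) :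
    components Z = {Z} := by
  ext Y
  simp only [components, Set.mem_ofPred_eq, Set.mem_singleton_iff]
  constructor
  · intro hY
    exact hY.eq_of_subset ⟨hZ, subset_rfl⟩ hY.prop.2
  · rintro rfl
    exact ⟨⟨hZ, subset_rfl⟩, fun W hW _ => hW.2⟩

/-- The irreducible closed subset cut out by a prime bihomogeneous form. -/
def irreducibleZeroLocus (hm : 1 ≤ m) (hk : 1 ≤ k) (hG : IsBihomogeneous G a b)
    (hGp : Prime G) : TopologicalSpace.IrreducibleCloseds (BiProj m k) :=
  ⟨zeroLocus G, isIrreducible_zeroLocus hm hk hG hGp, isClosed_zeroLocus hG⟩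

theorem coheight_irreducibleZeroLocus (hm : 1 ≤ m) (hk : 1 ≤ k) (hG : IsBihomogeneous G a b)
    (hGp : Prime G) : Order.coheight (irreducibleZeroLocus hm hk hG hGp) = 1 := by
  have hlt : ∀ W : TopologicalSpace.IrreducibleCloseds (BiProj m k),
      irreducibleZeroLocus hm hk hG hGp < W → (W : Set (BiProj m k)) = Set.univ := fun W hW =>
    eq_univ_of_zeroLocus_ssubset hm hk hG hGp W.isIrreducible W.isClosed
      (SetLike.coe_ssubset_coe.2 hW)
  have hmax : ∀ W : TopologicalSpace.IrreducibleCloseds (BiProj m k),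
      irreducibleZeroLocus hm hk hG hGp < W → Order.coheight W = 0 := by
    intro W hW
    rw [Order.coheight_eq_zero]
    intro V _ z _
    change z ∈ (W : Set (BiProj m k))
    rw [hlt W hW]
    trivial
  apply le_antisymm
  · rw [Order.coheight_eq_iSup_gt_coheight]
    refine iSup₂_le fun W hW => ?_
    rw [hmax W hW, zero_add]
  · rw [Order.one_le_iff_ne_zero, Order.coheight_ne_zero]
    intro h
    have h1 : (Set.univ : Set (BiProj m k)) ⊆ zeroLocus G :=
      h (b := ⟨Set.univ, isIrreducible_univ_biProj, isClosed_univ⟩) (fun z _ => trivial)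
    exact zeroLocus_ne_univ hG hGp.ne_zero (Set.univ_subset_iff.1 h1)

/-- The prime divisor cut out by a prime bihomogeneous form. -/
def primeDivisor (hm : 1 ≤ m) (hk : 1 ≤ k) (hG : IsBihomogeneous G a b)
    (hGp : Prime G) : PrimeDivisor m k :=
  ⟨irreducibleZeroLocus hm hk hG hGp, coheight_irreducibleZeroLocus hm hk hG hGp⟩

/-- A strict inclusion would force the smaller set to have coheight at least two. -/
theorem eq_primeDivisor_of_subset (hm : 1 ≤ m) (hk : 1 ≤ k) (hG : IsBihomogeneous G a b)
    (hGp : Prime G) (Z : PrimeDivisor m k) (h : (Z.1 : Set (BiProj m k)) ⊆ zeroLocus G) :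
    Z = primeDivisor hm hk hG hGp := by
  by_contra hne
  have hlt : Z.1 < irreducibleZeroLocus hm hk hG hGp :=
    lt_of_le_of_ne h fun h' => hne (Subtype.ext h')
  have h1 := Order.coheight_add_one_le hlt
  rw [coheight_irreducibleZeroLocus, Z.2] at h1
  exact absurd h1 (by decide)

theorem isDivisorial_zeroLocus (hm : 1 ≤ m) (hk : 1 ≤ k) (hG : IsBihomogeneous G a b)
    (hGp : Prime G) : IsDivisorial (zeroLocus G) := by
  refine ⟨isClosed_zeroLocus hG, fun Y hY => ⟨primeDivisor hm hk hG hGp, ?_⟩⟩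
  rw [components_of_isIrreducible (isIrreducible_zeroLocus hm hk hG hGp)] at hY
  exact hY.symm

theorem divisorClass_zeroLocus (hm : 1 ≤ m) (hk : 1 ≤ k) (hG : IsBihomogeneous G a b)
    (hGp : Prime G) : divisorClass (zeroLocus G) =
      QuotientAddGroup.mk (Finsupp.single (primeDivisor hm hk hG hGp) 1) := by
  have h : {D : PrimeDivisor m k | (D.1 : Set (BiProj m k)) ∈ components (zeroLocus G)} =
      {primeDivisor hm hk hG hGp} := by
    ext D
    rw [components_of_isIrreducible (isIrreducible_zeroLocus hm hk hG hGp)]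
    simp only [Set.mem_singleton_iff, Set.mem_ofPred_eq]
    exact ⟨fun h => eq_primeDivisor_of_subset hm hk hG hGp D h.subset, fun h => by rw [h]; rfl⟩
  rw [divisorClass, h, finsum_mem_singleton]

/-! ### Orders of vanishing -/

theorem subset_zeroLocus_of_mem_vanishingIdeal {Z : Set (BiProj m k)} {F : BiPoly m k}
    (hF : F ∈ vanishingIdeal Z) : Z ⊆ zeroLocus F := by
  intro z hz
  change F ∈ RingHom.ker (eval (Sum.elim z.1.rep z.2.rep))
  refine (Ideal.span_le.2 ?_ : vanishingIdeal Z ≤ _) hF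
  rintro F' ⟨-, hF'⟩
  exact hF' hz

theorem ordAlong_eq_zero {Z : PrimeDivisor m k} {F : BiPoly m k}
    (h : ¬ (Z.1 : Set (BiProj m k)) ⊆ zeroLocus F) : ordAlong Z F = 0 := by
  have hs : {r | F ∈ vanishingIdeal (Z.1 : Set (BiProj m k)) ^ r} = {0} := by
    ext r
    simp only [Set.mem_ofPred_eq, Set.mem_singleton_iff]
    refine ⟨fun hr => ?_, by rintro rfl; simp⟩
    by_contra hr0
    exact h (subset_zeroLocus_of_mem_vanishingIdeal (Ideal.pow_le_self hr0 hr))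
  rw [ordAlong, hs, csSup_singleton]

theorem vanishingIdeal_zeroLocus (hm : 1 ≤ m) (hk : 1 ≤ k) (hG : IsBihomogeneous G a b)
    (hGp : Prime G) : vanishingIdeal (zeroLocus G) = Ideal.span {G} := by
  apply le_antisymm
  · refine Ideal.span_le.2 ?_
    rintro F ⟨⟨c, d, hF⟩, h⟩
    exact Ideal.mem_span_singleton.2 (dvd_of_zeroLocus_subset hm hk hG hGp hF h)
  · rw [Ideal.span_singleton_le_iff_mem]
    exact Ideal.subset_span ⟨⟨a, b, hG⟩, subset_rfl⟩

/-- The ideal of the divisor is generated by `G`, so membership in its powers is divisibility by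
powers of `G`. -/
theorem ordAlong_primeDivisor (hm : 1 ≤ m) (hk : 1 ≤ k) (hG : IsBihomogeneous G a b)
    (hGp : Prime G) {H : BiPoly m k} (r : ℕ) (hH : ¬ G ∣ H) :
    ordAlong (primeDivisor hm hk hG hGp) (G ^ r * H) = r := by
  have hs : {n | G ^ r * H ∈
      vanishingIdeal ((primeDivisor hm hk hG hGp).1 : Set (BiProj m k)) ^ n} = Set.Iic r := by
    ext n
    change _ ∈ vanishingIdeal (zeroLocus G) ^ n ↔ _
    rw [vanishingIdeal_zeroLocus hm hk hG hGp, Ideal.span_singleton_pow, Ideal.mem_span_singleton,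
      Set.mem_Iic]
    refine ⟨fun h => ?_, fun h => (pow_dvd_pow G h).mul_right H⟩
    by_contra hlt
    have h1 : G ^ r * G ∣ G ^ r * H := (pow_succ G r ▸ pow_dvd_pow G (not_le.1 hlt)).trans h
    exact hH ((mul_dvd_mul_iff_left (pow_ne_zero r hGp.ne_zero)).1 h1)
  rw [ordAlong, hs, csSup_Iic]

/-- A prime bihomogeneous form of bidegree `(a, b)` cuts out a divisor of class
`a • H_1 + b • H_2`. -/
theorem divisorClass_zeroLocus_eq (hm : 1 ≤ m) (hk : 1 ≤ k) (hG : IsBihomogeneous G a b)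
    (hGp : Prime G) : divisorClass (zeroLocus G) = (a : ℤ) • classH1 m k + (b : ℤ) • classH2 m k := by
  classical
  have hl : Prime (X (Sum.inl 0) : BiPoly m k) := X_prime
  have hr : Prime (X (Sum.inr 0) : BiPoly m k) := X_prime
  set P := primeDivisor hm hk hG hGp with hP
  set L := primeDivisor hm hk (isBihomogeneous_inl 0) hl with hL
  set R := primeDivisor hm hk (isBihomogeneous_inr 0) hr with hR
  have hLR : L ≠ R := by
    intro h
    have h1 : zeroLocus (X (Sum.inl 0) : BiPoly m k) = zeroLocus (X (Sum.inr 0)) :=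
      congrArg (fun Z : PrimeDivisor m k => (Z.1 : Set (BiProj m k))) h
    have h2 := dvd_of_zeroLocus_subset hm hk (isBihomogeneous_inl 0) hl (isBihomogeneous_inr 0)
      h1.subset
    simp [X_dvd_X] at h2
  rw [classH1, classH2, divisorClass_zeroLocus hm hk hG hGp,
    divisorClass_zeroLocus hm hk (isBihomogeneous_inl 0) hl,
    divisorClass_zeroLocus hm hk (isBihomogeneous_inr 0) hr, ← hP, ← hL, ← hR,
    ← QuotientAddGroup.mk_zsmul, ← QuotientAddGroup.mk_zsmul, ← QuotientAddGroup.mk_add,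
    ← sub_eq_zero, ← QuotientAddGroup.mk_sub, QuotientAddGroup.eq_zero_iff]
  have hM : IsBihomogeneous (X (Sum.inl 0) ^ a * X (Sum.inr 0) ^ b : BiPoly m k) a b := by
    simpa using ((isBihomogeneous_inl (k := k) 0).pow a).mul ((isBihomogeneous_inr (m := m) 0).pow b)
  -- The difference of the two sides is the divisor of the rational function `G / (X_0 ^ a A_0 ^
  -- b)`. It remains to compare orders along each prime divisor.
  refine AddSubgroup.subset_closure ⟨G, X (Sum.inl 0) ^ a * X (Sum.inr 0) ^ b, a, b, hGp.ne_zero,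
    mul_ne_zero (pow_ne_zero _ hl.ne_zero) (pow_ne_zero _ hr.ne_zero), hG, hM, fun Z => ?_⟩
  have h1 : ordAlong Z G = if P = Z then 1 else 0 := by
    split_ifs with h
    · have h2 := ordAlong_primeDivisor hm hk hG hGp 1 (H := 1) fun h => hGp.not_isUnit
        (isUnit_of_dvd_one h)
      rwa [pow_one, mul_one, ← hP, h] at h2
    · exact ordAlong_eq_zero fun h' => h (eq_primeDivisor_of_subset hm hk hG hGp Z h').symm
  have h2 : ordAlong Z (X (Sum.inl 0) ^ a * X (Sum.inr 0) ^ b) =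
      (if L = Z then a else 0) + (if R = Z then b else 0) := by
    by_cases hLZ : L = Z
    · have h2 := ordAlong_primeDivisor hm hk (isBihomogeneous_inl 0) hl a
        (H := X (Sum.inr 0) ^ b) fun h => by simpa [X_dvd_X] using hl.dvd_of_dvd_pow h
      have hRZ : R ≠ Z := fun h => hLR (hLZ.trans h.symm)
      rw [if_pos hLZ, if_neg hRZ, add_zero, ← hLZ, hL, h2]
    by_cases hRZ : R = Z
    · have h2 := ordAlong_primeDivisor hm hk (isBihomogeneous_inr 0) hr b
        (H := X (Sum.inl 0) ^ a) fun h => by simpa [X_dvd_X] using hr.dvd_of_dvd_pow h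
      rw [if_neg hLZ, if_pos hRZ, zero_add, ← hRZ, hR, mul_comm, h2]
    rw [if_neg hLZ, if_neg hRZ]
    refine ordAlong_eq_zero fun h => ?_
    have h3 : (Z.1 : Set (BiProj m k)) ⊆
        zeroLocus (X (Sum.inl 0)) ∪ zeroLocus (X (Sum.inr 0)) := by
      intro z hz
      have h4 := h hz
      simp only [zeroLocus, Set.mem_ofPred_eq, map_mul, map_pow, mul_eq_zero] at h4
      exact h4.imp eq_zero_of_pow_eq_zero eq_zero_of_pow_eq_zero
    rcases isPreirreducible_iff_isClosed_union_isClosed.1 Z.1.isIrreducible.2 _ _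
      (isClosed_zeroLocus (isBihomogeneous_inl 0)) (isClosed_zeroLocus (isBihomogeneous_inr 0)) h3
      with h4 | h4
    · exact hLZ (eq_primeDivisor_of_subset hm hk (isBihomogeneous_inl 0) hl Z h4).symm
    · exact hRZ (eq_primeDivisor_of_subset hm hk (isBihomogeneous_inr 0) hr Z h4).symm
  rw [h1, h2]
  simp only [Finsupp.sub_apply, Finsupp.add_apply, Finsupp.smul_apply, Finsupp.single_apply]
  split_ifs <;> simp

end Prime

/-! ### Products of linear forms and removal of common factors -/

section HomogeneousFactors

variable {σ : Type*}

theorem irreducible_of_isHomogeneous_one {p : MvPolynomial σ ℂ} (hp : p.IsHomogeneous 1)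
    (hp0 : p ≠ 0) : Irreducible p := by
  refine irreducible_of_totalDegree_eq_one (hp.totalDegree hp0) fun x hx => ?_
  obtain ⟨d, hd⟩ := ne_zero_iff.1 hp0
  exact isUnit_of_dvd_unit (hx d) (isUnit_iff_ne_zero.2 hd)

theorem _root_.Associated.exists_isHomogeneous {p q : MvPolynomial σ ℂ} {n : ℕ}
    (h : Associated p q) (hp : p.IsHomogeneous n) : q.IsHomogeneous n := by
  obtain ⟨v, rfl⟩ := h
  obtain ⟨c, -, hc⟩ := MvPolynomial.isUnit_iff_eq_C_of_isReduced.1 v.isUnit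
  rw [hc]
  simpa using hp.mul (isHomogeneous_C σ c)

/-- By unique factorization, the only irreducible factors are the linear forms `f u` up to
constants. -/
theorem isHomogeneous_of_irreducible_dvd_prod {ι : Type*} {s : Finset ι}
    {f : ι → MvPolynomial σ ℂ} (hf : ∀ u ∈ s, (f u).IsHomogeneous 1) (hf0 : ∀ u ∈ s, f u ≠ 0)
    {r : ι → ℕ} {p : MvPolynomial σ ℂ} (hp : Irreducible p) (hd : p ∣ ∏ u ∈ s, f u ^ r u) :
    p.IsHomogeneous 1 := by
  obtain ⟨u, hu, h⟩ := hp.prime.exists_mem_finset_dvd hd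
  have h1 := hp.prime.dvd_of_dvd_pow h
  exact (hp.associated_of_dvd (irreducible_of_isHomogeneous_one (hf u hu) (hf0 u hu))
    h1).symm.exists_isHomogeneous (hf u hu)

/-- The common factors of a family of forms of the same degree can be removed, provided that the
irreducible factors are known to be homogeneous. -/
theorem exists_isHomogeneous_coprime {ι : Type*} {J : Finset ι} (hJ : J.Nonempty) (e : ℕ)
    (Q : ι → MvPolynomial σ ℂ) (hQ0 : ∀ j ∈ J, Q j ≠ 0) (hQ : ∀ j ∈ J, (Q j).IsHomogeneous e)
    (hdvd : ∀ j ∈ J, ∀ p, Irreducible p → p ∣ Q j → p.IsHomogeneous 1) :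
    ∃ e' ≤ e, ∃ (g : MvPolynomial σ ℂ) (Q' : ι → MvPolynomial σ ℂ),
      (∀ j ∈ J, Q j = g * Q' j) ∧ (∀ j ∈ J, (Q' j).IsHomogeneous e') ∧
      ∀ x, (∀ j ∈ J, x ∣ Q' j) → IsUnit x := by
  induction e generalizing Q with
  | zero =>
    refine ⟨0, le_rfl, 1, Q, fun j _ => (one_mul _).symm, hQ, fun x hx => ?_⟩
    obtain ⟨j, hj⟩ := hJ
    have h1 := (totalDegree_zero_iff_isHomogeneous σ).2 (hQ j hj)
    rw [totalDegree_eq_zero_iff_eq_C] at h1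
    refine isUnit_of_dvd_unit (hx j hj) ?_
    rw [h1]
    exact (isUnit_iff_ne_zero.2 fun h => hQ0 j hj (by rw [h1, h, C_0])).map C
  | succ e ih =>
    by_cases hcop : ∀ x, (∀ j ∈ J, x ∣ Q j) → IsUnit x
    · exact ⟨e + 1, le_rfl, 1, Q, fun j _ => (one_mul _).symm, hQ, hcop⟩
    push Not at hcop
    obtain ⟨x, hx, hxu⟩ := hcop
    obtain ⟨j₀, hj₀⟩ := hJ
    have hx0 : x ≠ 0 := ne_zero_of_dvd_ne_zero (hQ0 j₀ hj₀) (hx j₀ hj₀)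
    -- Dividing the whole family by `p`, which is a linear form, lowers the common degree by exactly
    -- one.
    obtain ⟨p, hp, hpx⟩ := WfDvdMonoid.exists_irreducible_factor hxu hx0
    have hp1 := hdvd j₀ hj₀ p hp (hpx.trans (hx j₀ hj₀))
    have hex : ∀ j, ∃ q, j ∈ J → Q j = p * q := fun j => by
      by_cases hj : j ∈ J
      · obtain ⟨q, hq⟩ := hpx.trans (hx j hj)
        exact ⟨q, fun _ => hq⟩
      · exact ⟨0, fun h => absurd h hj⟩
    choose q hq using hex
    have hq0 : ∀ j ∈ J, q j ≠ 0 := fun j hj h => hQ0 j hj (by rw [hq j hj, h, mul_zero])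
    obtain ⟨e', he', g, Q', h1, h2, h3⟩ := ih q hq0
      (fun j hj => by
        obtain ⟨n, hn, h⟩ := exists_isWeightedHomogeneous_of_mul hp1 hp.ne_zero (hq0 j hj)
          (hq j hj ▸ hQ j hj)
        obtain rfl : n = e := by omega
        exact h)
      (fun j hj p' hp' hd => hdvd j hj p' hp' (hq j hj ▸ hd.mul_left p))
    exact ⟨e', by omega, p * g, Q', fun j hj => by rw [hq j hj, h1 j hj, mul_assoc], h2, h3⟩

end HomogeneousFactors

/-! ### Forms linear in the second factor, and their primality -/

/-- The form `∑ μ_j A_j Q_j(X)`. -/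
noncomputable def linearForm (J : Finset (Fin (k + 1))) (μ : Fin (k + 1) → ℂ)
    (Q : Fin (k + 1) → MvPolynomial (Fin (m + 1)) ℂ) : BiPoly m k :=
  ∑ j ∈ J, C (μ j) * X (Sum.inr j) * rename Sum.inl (Q j)

theorem eval_linearForm (J : Finset (Fin (k + 1))) (μ : Fin (k + 1) → ℂ)
    (Q : Fin (k + 1) → MvPolynomial (Fin (m + 1)) ℂ) (x : Fin (m + 1) → ℂ) (y : Fin (k + 1) → ℂ) :
    eval (Sum.elim x y) (linearForm J μ Q) = ∑ j ∈ J, μ j * y j * eval x (Q j) := by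
  simp [linearForm, eval_rename]

theorem isBihomogeneous_rename_inl {Q : MvPolynomial (Fin (m + 1)) ℂ} {e : ℕ}
    (hQ : Q.IsHomogeneous e) : IsBihomogeneous (rename Sum.inl Q : BiPoly m k) e 0 := by
  intro d hd
  obtain ⟨d', rfl, hd'⟩ := coeff_rename_ne_zero _ _ _ hd
  have h := hQ hd'
  rw [Finsupp.weight_apply, Finsupp.sum_mapDomain_index (by simp) (by simp [add_smul])]
  rw [Finsupp.weight_apply] at h
  simp only [Sum.elim_inl, Prod.smul_mk, smul_zero]
  rw [← h]
  simp only [Finsupp.sum, Pi.one_apply]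
  ext
  · simp [Prod.fst_sum]
  · simp [Prod.snd_sum]

theorem isBihomogeneous_linearForm {J : Finset (Fin (k + 1))} (μ : Fin (k + 1) → ℂ)
    {Q : Fin (k + 1) → MvPolynomial (Fin (m + 1)) ℂ} {e : ℕ}
    (hQ : ∀ j ∈ J, (Q j).IsHomogeneous e) : IsBihomogeneous (linearForm J μ Q) e 1 := by
  refine IsWeightedHomogeneous.sum _ _ _ fun j hj => ?_
  have h := (IsBihomogeneous.mul (isBihomogeneous_inr j) (isBihomogeneous_rename_inl (hQ j hj)))
  rw [zero_add, add_zero] at h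
  rw [mul_assoc]
  exact IsWeightedHomogeneous.C_mul h (μ j)

/-- In total degree one over a domain, one factor of any factorization is a constant; it divides
every coefficient `q j`, hence is a unit. -/
theorem irreducible_sum_C_mul_X {R ι : Type*} [CommRing R] [IsDomain R] {J : Finset ι}
    (q : ι → R) (hq0 : ∃ j ∈ J, q j ≠ 0) (hq : ∀ x, (∀ j ∈ J, x ∣ q j) → IsUnit x) :
    Irreducible (∑ j ∈ J, C (q j) * X j : MvPolynomial ι R) := by
  classical
  have hcoeff : ∀ j ∈ J, coeff (Finsupp.single j 1)
      (∑ j ∈ J, C (q j) * X j : MvPolynomial ι R) = q j := by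
    intro j hj
    rw [coeff_sum, Finset.sum_eq_single_of_mem j hj, coeff_C_mul, coeff_X, if_pos rfl, mul_one]
    intro j' _ hne
    rw [coeff_C_mul, coeff_X, if_neg, mul_zero]
    exact fun h => hne ((Finsupp.single_left_inj one_ne_zero).1 h)
  have hhom : (∑ j ∈ J, C (q j) * X j : MvPolynomial ι R).IsHomogeneous 1 :=
    IsHomogeneous.sum _ _ _ fun j _ => isHomogeneous_C_mul_X _ _
  refine irreducible_of_totalDegree_eq_one (hhom.totalDegree fun h => ?_) fun x hx => ?_
  · obtain ⟨j, hj, hj0⟩ := hq0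
    have h1 := hcoeff j hj
    rw [h, coeff_zero] at h1
    exact hj0 h1.symm
  · refine hq x fun j hj => ?_
    rw [← hcoeff j hj]
    exact hx _

theorem prime_linearForm {J : Finset (Fin (k + 1))} (hJ : J.Nonempty) {μ : Fin (k + 1) → ℂ}
    (hμ : ∀ j, μ j ≠ 0) {Q : Fin (k + 1) → MvPolynomial (Fin (m + 1)) ℂ}
    (hQ0 : ∀ j ∈ J, Q j ≠ 0) (hQ : ∀ x, (∀ j ∈ J, x ∣ Q j) → IsUnit x) :
    Prime (linearForm J μ Q) := by
  rw [← UniqueFactorizationMonoid.irreducible_iff_prime]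
  -- Reads a form as a polynomial in the `A_j` with coefficients in the polynomial ring in the
  -- `X_u`, where the form has degree one.
  let φ := (renameEquiv ℂ (Equiv.sumComm (Fin (m + 1)) (Fin (k + 1)))).trans
    (sumAlgEquiv ℂ (Fin (k + 1)) (Fin (m + 1)))
  have hφ : φ (linearForm J μ Q) = ∑ j ∈ J, C (C (μ j) * Q j) * X j := by
    have h1 : ∀ q : MvPolynomial (Fin (m + 1)) ℂ, φ (rename Sum.inl q) = C q := by
      intro q
      have h2 : φ.toAlgHom.comp (rename Sum.inl) =
          IsScalarTower.toAlgHom ℂ (MvPolynomial (Fin (m + 1)) ℂ) _ := by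
        ext u
        simp [φ]
      exact DFunLike.congr_fun h2 q
    have h3 : ∀ c : ℂ, φ (C c) = C (C c) := fun c => φ.commutes c
    have h4 : ∀ j, φ (X (Sum.inr j)) = X j := fun j => by simp [φ]
    rw [linearForm, map_sum]
    refine Finset.sum_congr rfl fun j _ => ?_
    rw [map_mul, map_mul, h1, h3, h4, C_mul]
    ring
  rw [← MulEquiv.irreducible_iff φ, hφ]
  have hunit : ∀ j, IsUnit (C (μ j) : MvPolynomial (Fin (m + 1)) ℂ) := fun j =>
    (isUnit_iff_ne_zero.2 (hμ j)).map C
  obtain ⟨j₀, hj₀⟩ := hJ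
  exact irreducible_sum_C_mul_X _ ⟨j₀, hj₀, mul_ne_zero (hunit j₀).ne_zero (hQ0 j₀ hj₀)⟩
    fun x hx => hQ x fun j hj => (hunit j).dvd_mul_left.1 (hx j hj)

/-! ### Binary forms -/

section BinaryForms

/-- The binary linear form that vanishes at `[p 0 : p 1]`. -/
noncomputable def lineForm (p : Fin 2 → ℂ) : MvPolynomial (Fin 2) ℂ := C (p 1) * X 0 - C (p 0) * X 1

/-- The determinant of two vectors of the plane. -/
def planeDet (p q : Fin 2 → ℂ) : ℂ := p 1 * q 0 - p 0 * q 1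

theorem eval_lineForm (p q : Fin 2 → ℂ) : eval q (lineForm p) = planeDet p q := by
  simp [lineForm, planeDet]

theorem planeDet_eq_zero_iff {p q : Fin 2 → ℂ} (hp : p ≠ 0) :
    planeDet p q = 0 ↔ ∃ a : ℂ, q = a • p := by
  constructor
  · intro h
    rw [planeDet, sub_eq_zero] at h
    by_cases h0 : p 0 = 0
    · have h1 : p 1 ≠ 0 := fun h1 => hp (by ext t; fin_cases t <;> simp [h0, h1])
      refine ⟨q 1 / p 1, ?_⟩
      ext t
      fin_cases t
      · rw [h0, zero_mul] at h
        simpa [h0] using (mul_eq_zero.1 h).resolve_left h1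
      · simp [h1]
    · refine ⟨q 0 / p 0, ?_⟩
      ext t
      fin_cases t
      · simp [h0]
      · change q 1 = q 0 / p 0 * p 1
        field_simp
        linear_combination -h
  · rintro ⟨a, rfl⟩
    simp [planeDet]
    ring

theorem planeDet_self (p : Fin 2 → ℂ) : planeDet p p = 0 := by
  rw [planeDet]
  ring

theorem planeDet_eq_zero_iff_mk {p q : Fin 2 → ℂ} (hp : p ≠ 0) (hq : q ≠ 0) :
    planeDet p q = 0 ↔ Projectivization.mk ℂ q hq = Projectivization.mk ℂ p hp := by
  rw [planeDet_eq_zero_iff hp, Projectivization.mk_eq_mk_iff']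
  exact exists_congr fun a => eq_comm

theorem isHomogeneous_lineForm (p : Fin 2 → ℂ) : (lineForm p).IsHomogeneous 1 :=
  (isHomogeneous_C_mul_X _ _).sub (isHomogeneous_C_mul_X _ _)

theorem lineForm_ne_zero {p : Fin 2 → ℂ} (hp : p ≠ 0) : lineForm p ≠ 0 := by
  intro h
  refine hp ?_
  ext t
  fin_cases t
  · have h1 := eval_lineForm p ![0, 1]
    rw [h] at h1
    simpa [planeDet] using h1
  · have h1 := eval_lineForm p ![1, 0]
    rw [h] at h1
    simpa [planeDet, eq_comm] using h1

theorem prime_lineForm {p : Fin 2 → ℂ} (hp : p ≠ 0) : Prime (lineForm p) :=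
  (irreducible_of_isHomogeneous_one (isHomogeneous_lineForm p) (lineForm_ne_zero hp)).prime

theorem lineForm_smul (a : ℂ) (p : Fin 2 → ℂ) : lineForm (a • p) = C a * lineForm p := by
  simp [lineForm]
  ring

theorem not_lineForm_dvd_lineForm {p q : Fin 2 → ℂ} (h : planeDet q p ≠ 0) :
    ¬ lineForm p ∣ lineForm q := by
  rintro ⟨g, hg⟩
  have h1 := congrArg (eval p) hg
  rw [map_mul, eval_lineForm, eval_lineForm, planeDet_self, zero_mul] at h1
  exact h h1

/-- The zeros of `lineForm p` are the multiples of `p`, where `F` vanishes by homogeneity. The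
Nullstellensatz for the prime ideal of `lineForm p` concludes. -/
theorem lineForm_dvd {F : MvPolynomial (Fin 2) ℂ} {n : ℕ} (hF : F.IsHomogeneous n)
    {p : Fin 2 → ℂ} (hp : p ≠ 0) (h : eval p F = 0) : lineForm p ∣ F := by
  have : (Ideal.span {lineForm p}).IsPrime :=
    (Ideal.span_singleton_prime (lineForm_ne_zero hp)).2 (prime_lineForm hp)
  rw [← Ideal.mem_span_singleton, ← MvPolynomial.IsPrime.vanishingIdeal_zeroLocus (K := ℂ)
    (Ideal.span {lineForm p}), MvPolynomial.mem_vanishingIdeal_iff]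
  intro z hz
  rw [MvPolynomial.zeroLocus_span] at hz
  have hz0 : eval z (lineForm p) = 0 := by simpa [aeval_eq_eval] using hz
  rw [eval_lineForm, planeDet_eq_zero_iff hp] at hz0
  obtain ⟨a, rfl⟩ := hz0
  rw [aeval_eq_eval, eval_smul_of_isHomogeneous hF, h, mul_zero]

/-- By the Nullstellensatz `g` divides a power of each variable. These powers are coprime, so `g` is
a unit. -/
theorem eq_C_of_forall_eval_ne_zero {g : MvPolynomial (Fin 2) ℂ}
    (h : ∀ q : Fin 2 → ℂ, q ≠ 0 → eval q g ≠ 0) : ∃ c : ℂ, g = C c := by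
  have hdvd : ∀ t : Fin 2, ∃ n : ℕ, g ∣ X t ^ n := by
    intro t
    have h1 : (X t : MvPolynomial (Fin 2) ℂ) ∈ (Ideal.span {g}).radical := by
      rw [← MvPolynomial.vanishingIdeal_zeroLocus_eq_radical (K := ℂ) (Ideal.span {g}),
        MvPolynomial.mem_vanishingIdeal_iff]
      intro z hz
      rw [MvPolynomial.zeroLocus_span] at hz
      have hz0 : eval z g = 0 := by simpa [aeval_eq_eval] using hz
      have hz1 : z = 0 := by
        by_contra hne
        exact h z hne hz0
      simp [hz1]
    obtain ⟨n, hn⟩ := h1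
    exact ⟨n, Ideal.mem_span_singleton.1 hn⟩
  obtain ⟨a, ha⟩ := hdvd 0
  obtain ⟨b, hb⟩ := hdvd 1
  have hrel : IsRelPrime (X 0 ^ a : MvPolynomial (Fin 2) ℂ) (X 1 ^ b) :=
    IsRelPrime.pow ((X_prime (R := ℂ)).irreducible.isRelPrime_iff_not_dvd.2 fun h => by
      simp [X_dvd_X] at h)
  obtain ⟨c, -, hc⟩ := MvPolynomial.isUnit_iff_eq_C_of_isReduced.1 (hrel ha hb)
  exact ⟨c, hc⟩

/-- A binary form with prescribed zeros and multiplicities is a product of linear forms. -/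
theorem exists_eq_C_mul_prod_lineForm {ι : Type*} [Fintype ι] [Nonempty ι] {p : ι → Fin 2 → ℂ}
    (hp : ∀ u, p u ≠ 0) (hpp : ∀ u v, u ≠ v → planeDet (p u) (p v) ≠ 0)
    {F : MvPolynomial (Fin 2) ℂ} {n : ℕ} (hF : F.IsHomogeneous n) {r : ι → ℕ}
    (hr : ∀ u, emultiplicity (lineForm (p u)) F = r u)
    (hz : ∀ q, q ≠ 0 → eval q F = 0 → ∃ u, planeDet (p u) q = 0) :
    ∃ c : ℂ, c ≠ 0 ∧ F = C c * ∏ u, lineForm (p u) ^ r u := by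
  have hF0 : F ≠ 0 := by
    rintro rfl
    simpa using hr (Classical.arbitrary ι)
  obtain ⟨g, hg⟩ : ∏ u, lineForm (p u) ^ r u ∣ F := by
    refine Finset.prod_dvd_of_isRelPrime (fun u _ v _ huv => ?_) fun u _ => ?_
    · exact IsRelPrime.pow ((prime_lineForm (hp u)).irreducible.isRelPrime_iff_not_dvd.2
        (not_lineForm_dvd_lineForm (hpp v u huv.symm)))
    · exact pow_dvd_of_le_emultiplicity (hr u).ge
  have hP : (∏ u, lineForm (p u) ^ r u).IsHomogeneous (∑ u, 1 * r u) :=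
    IsHomogeneous.prod _ _ _ fun u _ => (isHomogeneous_lineForm (p u)).pow (r u)
  have hg0 : g ≠ 0 := right_ne_zero_of_mul (hg ▸ hF0)
  obtain ⟨e, -, hge⟩ := exists_isWeightedHomogeneous_of_mul hP (left_ne_zero_of_mul (hg ▸ hF0)) hg0
    (hg ▸ hF)
  -- A zero of the cofactor `g` away from the origin would be proportional to some `p u`, so
  -- `lineForm (p u)` would divide `F` once more than `r u` allows.
  obtain ⟨c, rfl⟩ : ∃ c, g = C c := by
    refine eq_C_of_forall_eval_ne_zero fun q hq hgq => ?_
    obtain ⟨u, hu⟩ := hz q hq (by rw [hg, map_mul, hgq, mul_zero])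
    obtain ⟨a, rfl⟩ := (planeDet_eq_zero_iff (hp u)).1 hu
    rw [eval_smul_of_isHomogeneous hge] at hgq
    have ha : a ≠ 0 := by rintro rfl; simp at hq
    have h1 := lineForm_dvd hge (hp u) ((mul_eq_zero.1 hgq).resolve_left (pow_ne_zero _ ha))
    have h2 : lineForm (p u) ^ (r u + 1) ∣ F := by
      rw [hg, pow_succ]
      exact mul_dvd_mul (Finset.dvd_prod_of_mem _ (Finset.mem_univ u)) h1
    have h3 := le_emultiplicity_of_pow_dvd h2
    rw [hr u] at h3
    norm_cast at h3
    omega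
  exact ⟨c, by rintro rfl; simp at hg0, by rw [hg, mul_comm]⟩

theorem emultiplicity_C_mul_prod_lineForm {ι : Type*} [Fintype ι] [DecidableEq ι]
    {p : ι → Fin 2 → ℂ} (hp : ∀ u, p u ≠ 0) (hpp : ∀ u v, u ≠ v → planeDet (p u) (p v) ≠ 0)
    {c : ℂ} (hc : c ≠ 0) (r : ι → ℕ) (v : ι) :
    emultiplicity (lineForm (p v)) (C c * ∏ u, lineForm (p u) ^ r u) = r v := by
  have hpr := prime_lineForm (hp v)
  have hC : emultiplicity (lineForm (p v)) (C c) = 0 :=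
    emultiplicity_eq_zero.2 fun h => hpr.not_isUnit
      (isUnit_of_dvd_unit h ((isUnit_iff_ne_zero.2 hc).map C))
  rw [emultiplicity_mul hpr, hC, zero_add, Finset.emultiplicity_prod hpr,
    Finset.sum_eq_single_of_mem v (Finset.mem_univ v)]
  · exact emultiplicity_pow_self_of_prime hpr _
  · intro u _ hu
    rw [emultiplicity_pow hpr, emultiplicity_eq_zero.2 (not_lineForm_dvd_lineForm (hpp u v hu)),
      mul_zero]

theorem contactOrder_mk (F : MvPolynomial (Fin 2) ℂ) {p : Fin 2 → ℂ} (hp : p ≠ 0) :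
    contactOrder F (Projectivization.mk ℂ p hp) = emultiplicity (lineForm p) F := by
  obtain ⟨a, ha⟩ := Projectivization.exists_smul_eq_mk_rep ℂ p hp
  change emultiplicity (lineForm (Projectivization.mk ℂ p hp).rep) F = _
  rw [← ha, Units.smul_def, lineForm_smul]
  have h : Associated (C (a : ℂ) * lineForm p) (lineForm p) :=
    associated_unit_mul_left _ _ ((isUnit_iff_ne_zero.2 a.ne_zero).map C)
  exact emultiplicity_eq_of_associated_left h.symm

theorem exists_rep_mk_eq_smul {r : ℕ} {p : Fin (r + 1) → ℂ} (hp : p ≠ 0) :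
    ∃ a : ℂ, a ≠ 0 ∧ (Projectivization.mk ℂ p hp).rep = a • p := by
  obtain ⟨a, ha⟩ := Projectivization.exists_smul_eq_mk_rep ℂ p hp
  exact ⟨a, a.ne_zero, ha.symm⟩

end BinaryForms

/-! ### The marked points -/

/-- Coordinates of the marked points: `[0 : 1]`, `[1 : 1]`, `[1 : 0]`, and then `[x_u : 1]`. -/
def stdPoint (x : Fin m → ℂ) : Fin (m + 3) → Fin 2 → ℂ :=
  Fin.cons ![0, 1] (Fin.cons ![1, 1] (Fin.cons ![1, 0] fun u => ![x u, 1]))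

theorem stdPoint_zero (x : Fin m → ℂ) : stdPoint x 0 = ![0, 1] := rfl

theorem stdPoint_one (x : Fin m → ℂ) : stdPoint x 1 = ![1, 1] := rfl

theorem stdPoint_two (x : Fin m → ℂ) : stdPoint x 2 = ![1, 0] := rfl

theorem stdPoint_addNat (x : Fin m → ℂ) (u : Fin m) : stdPoint x (u.addNat 3) = ![x u, 1] := rfl

@[elab_as_elim]
theorem marking_cases {P : Fin (m + 3) → Prop} (h0 : P 0) (h1 : P 1) (h2 : P 2)
    (h3 : ∀ u : Fin m, P (u.addNat 3)) (v : Fin (m + 3)) : P v := by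
  refine Fin.cases h0 (fun v => ?_) v
  refine Fin.cases h1 (fun v => ?_) v
  exact Fin.cases h2 h3 v

theorem stdPoint_ne_zero (x : Fin m → ℂ) (v : Fin (m + 3)) : stdPoint x v ≠ 0 := by
  induction v using marking_cases with
  | h0 => exact fun h => one_ne_zero (congrFun h 1)
  | h1 => exact fun h => one_ne_zero (congrFun h 1)
  | h2 => exact fun h => one_ne_zero (congrFun h 0)
  | h3 u => exact fun h => one_ne_zero (congrFun h 1)

theorem addNat_ne_two (u : Fin m) : u.addNat 3 ≠ 2 := by
  intro h
  have h1 : (u : ℕ) + 3 = 2 % (m + 3) := congrArg Fin.val h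
  rw [Nat.mod_eq_of_lt (by omega)] at h1
  omega

theorem stdPoint_snd {x : Fin m → ℂ} {v : Fin (m + 3)} (hv : v ≠ 2) : stdPoint x v 1 = 1 := by
  induction v using marking_cases with
  | h0 => rfl
  | h1 => rfl
  | h2 => exact absurd rfl hv
  | h3 u => rfl

/-- The marked points are distinct. -/
def Distinct (x : Fin m → ℂ) : Prop :=
  ∀ u v, u ≠ v → planeDet (stdPoint x u) (stdPoint x v) ≠ 0

/-- The affine coordinates of the markings other than `[1 : 0]`, homogenized. -/
noncomputable def affCoord : Fin (m + 3) → MvPolynomial (Fin (m + 1)) ℂ :=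
  Fin.cons 0 (Fin.cons (X 0) (Fin.cons 0 fun u => X u.succ))

theorem isHomogeneous_affCoord (v : Fin (m + 3)) :
    (affCoord v : MvPolynomial (Fin (m + 1)) ℂ).IsHomogeneous 1 := by
  induction v using marking_cases with
  | h0 => exact isHomogeneous_zero _ _ _
  | h1 => exact isHomogeneous_X _ _
  | h2 => exact isHomogeneous_zero _ _ _
  | h3 u => exact isHomogeneous_X _ _

theorem eval_affCoord (x : Fin m → ℂ) {v : Fin (m + 3)} (hv : v ≠ 2) :
    eval (Fin.cons 1 x : Fin (m + 1) → ℂ) (affCoord v) = stdPoint x v 0 := by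
  induction v using marking_cases with
  | h0 => exact map_zero _
  | h1 => exact eval_X 0
  | h2 => exact absurd rfl hv
  | h3 u => exact eval_X u.succ

/-- The form `X_v - X_u` that cuts out the locus where the markings `u` and `v` collide. -/
noncomputable def collision (v u : Fin (m + 3)) : MvPolynomial (Fin (m + 1)) ℂ :=
  -- The determinant of `[x_u : 1]` with `[1 : 0]` is the constant 1, whose homogenization in degree
  -- one is `X 0`.
  if v = 2 then X 0 else affCoord v - affCoord u

theorem isHomogeneous_collision (v u : Fin (m + 3)) :
    (collision v u : MvPolynomial (Fin (m + 1)) ℂ).IsHomogeneous 1 := by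
  unfold collision
  split_ifs
  · exact isHomogeneous_X _ _
  · exact (isHomogeneous_affCoord v).sub (isHomogeneous_affCoord u)

theorem eval_collision (x : Fin m → ℂ) (v : Fin (m + 3)) {u : Fin (m + 3)} (hu : u ≠ 2) :
    eval (Fin.cons 1 x : Fin (m + 1) → ℂ) (collision v u) =
      planeDet (stdPoint x u) (stdPoint x v) := by
  unfold collision planeDet
  rw [stdPoint_snd hu]
  split_ifs with hv
  · subst hv
    simp [stdPoint_two]
  · rw [map_sub, eval_affCoord x hv, eval_affCoord x hu, stdPoint_snd hv]
    ring

/-- The value does not depend on `v`, so the marking `[1 : 0]` contributes equally at `i₀` and at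
`i` and can be left out of the transfer forms. -/
theorem planeDet_two {x : Fin m → ℂ} {v : Fin (m + 3)} (hv : v ≠ 2) :
    planeDet (stdPoint x 2) (stdPoint x v) = -1 := by
  simp [planeDet, stdPoint_two, stdPoint_snd hv]

theorem planeDet_swap (p q : Fin 2 → ℂ) : planeDet q p = -planeDet p q := by
  unfold planeDet
  ring

theorem distinct_of_forall_collision {x : Fin m → ℂ} (h : ∀ u v, u ≠ v → u ≠ 2 → v ≠ 2 →
    eval (Fin.cons 1 x : Fin (m + 1) → ℂ) (collision v u) ≠ 0) : Distinct x := by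
  intro u v huv
  by_cases hu : u = 2
  · subst hu
    rw [planeDet_two huv.symm]
    norm_num
  by_cases hv : v = 2
  · subst hv
    rw [planeDet_swap, planeDet_two huv]
    norm_num
  · rw [← eval_collision x v hu]
    exact h u v huv hu hv

theorem exists_distinct (m : ℕ) : ∃ x : Fin m → ℂ, Distinct x := by
  -- The finite markings are placed at 0, 1, 2, 3, …; skipping the index of `[1 : 0]` accounts for
  -- the shift by one in `key`.
  refine ⟨fun u => ((u + 2 : ℕ) : ℂ), distinct_of_forall_collision fun u v huv hu hv => ?_⟩
  have key : ∀ w : Fin (m + 3), w ≠ 2 → stdPoint (fun u : Fin m => ((u + 2 : ℕ) : ℂ)) w 0 =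
      (if (w : ℕ) ≤ 2 then (w : ℕ) else (w : ℕ) - 1 : ℕ) := by
    intro w hw
    induction w using marking_cases with
    | h0 => simp [stdPoint_zero]
    | h1 => simp [stdPoint_one]
    | h2 => exact absurd rfl hw
    | h3 u => simp [stdPoint_addNat]
  rw [eval_collision _ _ hu, planeDet, stdPoint_snd hu, stdPoint_snd hv, key u hu, key v hv,
    one_mul, mul_one, sub_ne_zero, Ne, Nat.cast_inj]
  have h2 : ((2 : Fin (m + 3)) : ℕ) = 2 := Nat.mod_eq_of_lt (show 2 < m + 3 by omega)
  have hu' : (u : ℕ) ≠ 2 := fun h => hu (Fin.ext (h.trans h2.symm))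
  have hv' : (v : ℕ) ≠ 2 := fun h => hv (Fin.ext (h.trans h2.symm))
  have huv' : (u : ℕ) ≠ v := fun h => huv (Fin.ext h)
  split_ifs <;> omega

/-! ### Maps with prescribed contact orders -/

theorem mk_stdPoint_injective {x : Fin m → ℂ} (hx : Distinct x) : Function.Injective
    fun v => Projectivization.mk ℂ (stdPoint x v) (stdPoint_ne_zero x v) := by
  intro u v h
  by_contra huv
  exact hx v u (Ne.symm huv)
    ((planeDet_eq_zero_iff_mk (stdPoint_ne_zero x v) (stdPoint_ne_zero x u)).2 h)

/-- The value at the marking `v` of the product of the linear forms that vanish at the markings. -/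
noncomputable def contactProd (α : Fin (m + 3) → Fin (k + 1) → ℕ) (x : Fin m → ℂ) (v : Fin (m + 3))
    (j : Fin (k + 1)) : ℂ :=
  ∏ u, planeDet (stdPoint x u) (stdPoint x v) ^ α u j

namespace LogMap

variable {α : Fin (m + 3) → Fin (k + 1) → ℕ}

/-- The affine coordinates of the free markings. -/
noncomputable def coord (f : LogMap α) (u : Fin m) : ℂ :=
  (f.marking (u.addNat 3)).rep 0 / (f.marking (u.addNat 3)).rep 1

theorem marking_eq (f : LogMap α) (v : Fin (m + 3)) : f.marking v =
    Projectivization.mk ℂ (stdPoint f.coord v) (stdPoint_ne_zero _ v) := by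
  refine marking_cases (P := fun v => f.marking v =
    Projectivization.mk ℂ (stdPoint f.coord v) (stdPoint_ne_zero _ v))
    f.marking_zero f.marking_one f.marking_two (fun u => ?_) v
  have h1 : (f.marking (u.addNat 3)).rep 1 ≠ 0 := by
    intro h
    refine addNat_ne_two u (f.marking_injective ?_)
    rw [f.marking_two, ← Projectivization.mk_rep (f.marking (u.addNat 3)), linePoint,
      Projectivization.mk_eq_mk_iff']
    refine ⟨(f.marking (u.addNat 3)).rep 0, ?_⟩
    ext t
    fin_cases t <;> simp [h]
  nth_rewrite 1 [← Projectivization.mk_rep (f.marking (u.addNat 3))]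
  rw [Projectivization.mk_eq_mk_iff']
  refine ⟨(f.marking (u.addNat 3)).rep 1, ?_⟩
  rw [stdPoint_addNat]
  ext t
  fin_cases t
  · simp [coord, mul_div_cancel₀ _ h1]
  · simp

theorem distinct_coord (f : LogMap α) : Distinct f.coord := by
  intro u v huv h
  rw [planeDet_eq_zero_iff_mk (stdPoint_ne_zero _ u) (stdPoint_ne_zero _ v), ← f.marking_eq,
    ← f.marking_eq] at h
  exact huv (f.marking_injective h).symm

/-- Each form vanishes only at markings, with prescribed multiplicities, so it is determined up to a
nonzero constant. -/
theorem exists_form_eq (f : LogMap α) : ∃ c : Fin (k + 1) → ℂ, (∀ j, c j ≠ 0) ∧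
    ∀ j, f.form j = C (c j) * ∏ u, lineForm (stdPoint f.coord u) ^ α u j := by
  have h : ∀ j, ∃ c : ℂ, c ≠ 0 ∧
      f.form j = C c * ∏ u, lineForm (stdPoint f.coord u) ^ α u j := by
    intro j
    refine exists_eq_C_mul_prod_lineForm (stdPoint_ne_zero _) f.distinct_coord
      (f.form_homogeneous j) (fun u => ?_) fun q hq hq0 => ?_
    · rw [← contactOrder_mk _ (stdPoint_ne_zero _ u), ← f.marking_eq, f.contact]
    · obtain ⟨a, -, ha⟩ := exists_rep_mk_eq_smul hq
      obtain ⟨u, hu⟩ := f.boundary (Projectivization.mk ℂ q hq) j (by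
        rw [ha, eval_smul_of_isHomogeneous (f.form_homogeneous j), hq0, mul_zero])
      refine ⟨u, ?_⟩
      rw [planeDet_eq_zero_iff_mk (stdPoint_ne_zero _ u) hq, ← hu, f.marking_eq]
  choose c hc hf using h
  exact ⟨c, hc, hf⟩

theorem eval_form (f : LogMap α) {c : Fin (k + 1) → ℂ} {x : Fin m → ℂ}
    (hf : ∀ j, f.form j = C (c j) * ∏ u, lineForm (stdPoint x u) ^ α u j)
    (v : Fin (m + 3)) (j : Fin (k + 1)) :
    eval (stdPoint x v) (f.form j) = c j * contactProd α x v j := by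
  simp [hf, contactProd, eval_lineForm]

/-- Allows evaluation at the explicit coordinates `stdPoint x v`: another representative scales all
forms by the same power, as they share a degree. -/
theorem exists_ev_eq (f : LogMap α) {x : Fin m → ℂ} (v : Fin (m + 3))
    (hv : f.marking v = Projectivization.mk ℂ (stdPoint x v) (stdPoint_ne_zero x v)) :
    ∃ h, f.ev v = Projectivization.mk ℂ (fun j => eval (stdPoint x v) (f.form j)) h := by
  obtain ⟨a, ha, har⟩ := exists_rep_mk_eq_smul (stdPoint_ne_zero x v)
  have key : ∀ j, eval (f.marking v).rep (f.form j) =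
      a ^ f.degree * eval (stdPoint x v) (f.form j) := fun j => by
    rw [hv, har, eval_smul_of_isHomogeneous (f.form_homogeneous j)]
  have h : (fun j => eval (stdPoint x v) (f.form j)) ≠ 0 := by
    obtain ⟨j, hj⟩ := f.base_point_free (f.marking v)
    rw [key] at hj
    exact fun h => right_ne_zero_of_mul hj (congrFun h j)
  refine ⟨h, ?_⟩
  rw [ev, toFun, Projectivization.mk_eq_mk_iff']
  exact ⟨a ^ f.degree, funext fun j => (key j).symm⟩

theorem fgt_eq (f : LogMap α) {x : Fin m → ℂ} (hf : ∀ v, f.marking v =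
    Projectivization.mk ℂ (stdPoint x v) (stdPoint_ne_zero x v)) :
    f.fgt = Projectivization.mk ℂ (Fin.cons 1 x : Fin (m + 1) → ℂ)
      (fun h => one_ne_zero (congrFun h 0)) := by
  have h : f.coord = x := by
    funext u
    obtain ⟨a, ha, har⟩ := exists_rep_mk_eq_smul (stdPoint_ne_zero x (u.addNat 3))
    rw [coord, hf, har, stdPoint_addNat]
    simp [ha]
  subst h
  rfl

/-- The map with markings `x` and forms `c_j ∏_u (T_u X - S_u Y)^{α_uj}`. -/
noncomputable def ofCoord {d : ℕ} (hbal : ∀ j, ∑ i, α i j = d) (htan : ∀ i, ∃ j, α i j = 0)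
    {x : Fin m → ℂ} (hx : Distinct x) {c : Fin (k + 1) → ℂ} (hc : ∀ j, c j ≠ 0) : LogMap α :=
  have hzero : ∀ (q : ProjSpace 1) (j : Fin (k + 1)),
      eval q.rep (C (c j) * ∏ u, lineForm (stdPoint x u) ^ α u j) = 0 →
      ∃ u, α u j ≠ 0 ∧ q = Projectivization.mk ℂ (stdPoint x u) (stdPoint_ne_zero x u) := by
    intro q j h
    simp only [map_mul, eval_C, eval_prod, map_pow, mul_eq_zero, hc j, false_or,
      Finset.prod_eq_zero_iff, Finset.mem_univ, true_and, pow_eq_zero_iff'] at h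
    obtain ⟨u, h, hu⟩ := h
    refine ⟨u, hu, ?_⟩
    rwa [eval_lineForm, planeDet_eq_zero_iff_mk (stdPoint_ne_zero x u) q.rep_nonzero,
      Projectivization.mk_rep] at h
  { marking := fun v => Projectivization.mk ℂ (stdPoint x v) (stdPoint_ne_zero x v)
    marking_injective := mk_stdPoint_injective hx
    marking_zero := rfl
    marking_one := rfl
    marking_two := rfl
    degree := d
    form := fun j => C (c j) * ∏ u, lineForm (stdPoint x u) ^ α u j
    form_homogeneous := fun j => by
      have h := (isHomogeneous_C (Fin 2) (c j)).mul (IsHomogeneous.prod Finset.univ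
        (fun u => lineForm (stdPoint x u) ^ α u j) (fun u => 1 * α u j)
        fun u _ => (isHomogeneous_lineForm _).pow _)
      simpa only [one_mul, zero_add, hbal] using h
    -- A common zero would be a marking `u`. But `htan` gives `j` with `α u j = 0`, and the `j`-th
    -- form vanishes only at markings of positive contact order with it.
    base_point_free := fun q => by
      by_contra! h
      obtain ⟨u, -, hu⟩ := hzero q 0 (h 0)
      obtain ⟨j, hj⟩ := htan u
      obtain ⟨v, hv, hv'⟩ := hzero q j (h j)
      rw [mk_stdPoint_injective hx (hu.symm.trans hv')] at hj
      exact hv hj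
    contact := fun i j => by
      rw [contactOrder_mk, emultiplicity_C_mul_prod_lineForm (stdPoint_ne_zero x) hx (hc j)]
    boundary := fun q j h => by
      obtain ⟨u, -, hu⟩ := hzero q j h
      exact ⟨u, hu.symm⟩ }

end LogMap

/-! ### The equation of the preimage of a hyperplane -/

section Transfer

variable (α : Fin (m + 3) → Fin (k + 1) → ℕ) (i₀ i : Fin (m + 3))

/-- The markings whose collisions with `i₀` and `i` matter. -/
def otherMarkings : Finset (Fin (m + 3)) := Finset.univ.filter fun u => u ≠ 2 ∧ u ≠ i ∧ u ≠ i₀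

/-- The form by which the `j`-th coordinate is multiplied when the value at `i₀` is replaced by the
value at `i`, up to a factor that does not depend on `j`. -/
noncomputable def transferForm (j : Fin (k + 1)) : MvPolynomial (Fin (m + 1)) ℂ :=
  -- The exponents of the two collisions for a given `u` add up to the maximum of `α u`, so the
  -- degree is independent of `j`.
  (∏ u ∈ otherMarkings i₀ i, collision i u ^ α u j) *
    ∏ u ∈ otherMarkings i₀ i, collision i₀ u ^ (Finset.univ.sup (α u) - α u j)

variable {i₀ i}

theorem eval_collision_ne_zero {x : Fin m → ℂ} (hx : Distinct x) {u v : Fin (m + 3)} (hu : u ≠ 2)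
    (huv : u ≠ v) : eval (Fin.cons 1 x : Fin (m + 1) → ℂ) (collision v u) ≠ 0 := by
  rw [eval_collision x v hu]
  exact hx u v huv

theorem collision_ne_zero {u v : Fin (m + 3)} (hu : u ≠ 2) (huv : u ≠ v) :
    (collision v u : MvPolynomial (Fin (m + 1)) ℂ) ≠ 0 := by
  obtain ⟨x, hx⟩ := exists_distinct m
  intro h
  exact eval_collision_ne_zero hx hu huv (by rw [h, map_zero])

theorem isHomogeneous_transferForm (j : Fin (k + 1)) : (transferForm α i₀ i j).IsHomogeneous
    (∑ u ∈ otherMarkings i₀ i, Finset.univ.sup (α u)) := by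
  have h := (IsHomogeneous.prod (otherMarkings i₀ i) (fun u => collision i u ^ α u j)
      (fun u => 1 * α u j) fun u _ => (isHomogeneous_collision i u).pow _).mul
    (IsHomogeneous.prod (otherMarkings i₀ i)
      (fun u => collision i₀ u ^ (Finset.univ.sup (α u) - α u j))
      (fun u => 1 * (Finset.univ.sup (α u) - α u j))
      fun u _ => (isHomogeneous_collision i₀ u).pow _)
  rw [← Finset.sum_add_distrib] at h
  rwa [Finset.sum_congr rfl fun u _ => show 1 * α u j + 1 * (Finset.univ.sup (α u) - α u j) =
    Finset.univ.sup (α u) from ?_] at h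
  have h1 : α u j ≤ Finset.univ.sup (α u) := Finset.le_sup (f := α u) (Finset.mem_univ j)
  omega

theorem eval_transferForm_ne_zero {x : Fin m → ℂ} (hx : Distinct x) (j : Fin (k + 1)) :
    eval (Fin.cons 1 x : Fin (m + 1) → ℂ) (transferForm α i₀ i j) ≠ 0 := by
  simp only [transferForm, map_mul, map_prod, map_pow]
  refine mul_ne_zero (Finset.prod_ne_zero_iff.2 fun u hu => pow_ne_zero _ ?_)
    (Finset.prod_ne_zero_iff.2 fun u hu => pow_ne_zero _ ?_) <;>
  obtain ⟨h2, hi, hi₀⟩ := (Finset.mem_filter.1 hu).2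
  · exact eval_collision_ne_zero hx h2 hi
  · exact eval_collision_ne_zero hx h2 hi₀

theorem transferForm_ne_zero (j : Fin (k + 1)) : transferForm α i₀ i j ≠ 0 := by
  obtain ⟨x, hx⟩ := exists_distinct m
  intro h
  exact eval_transferForm_ne_zero α hx j (by rw [h, map_zero])

theorem isHomogeneous_of_irreducible_dvd_transferForm (j : Fin (k + 1))
    {p : MvPolynomial (Fin (m + 1)) ℂ} (hp : Irreducible p) (h : p ∣ transferForm α i₀ i j) :
    p.IsHomogeneous 1 := by
  rcases hp.prime.dvd_or_dvd h with h | h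
  · exact isHomogeneous_of_irreducible_dvd_prod (fun u _ => isHomogeneous_collision i u)
      (fun u hu => collision_ne_zero (Finset.mem_filter.1 hu).2.1 (Finset.mem_filter.1 hu).2.2.1)
      hp h
  · exact isHomogeneous_of_irreducible_dvd_prod (fun u _ => isHomogeneous_collision i₀ u)
      (fun u hu => collision_ne_zero (Finset.mem_filter.1 hu).2.1 (Finset.mem_filter.1 hu).2.2.2)
      hp h

theorem contactProd_ne_zero {x : Fin m → ℂ} (hx : Distinct x) {v : Fin (m + 3)}
    {j : Fin (k + 1)} (hv : α v j = 0) : contactProd α x v j ≠ 0 := by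
  refine Finset.prod_ne_zero_iff.2 fun u _ => ?_
  by_cases h : u = v
  · rw [h, hv, pow_zero]
    exact one_ne_zero
  · exact pow_ne_zero _ (hx u v h)

theorem contactProd_eq_zero {x : Fin m → ℂ} {v : Fin (m + 3)}
    {j : Fin (k + 1)} (hv : α v j ≠ 0) : contactProd α x v j = 0 :=
  Finset.prod_eq_zero (Finset.mem_univ v) (by rw [planeDet_self, zero_pow hv])

/-- The product of the `collision i₀ u` to the maximal exponents clears the denominators of
`contactProd α x i j / contactProd α x i₀ j` for all `j` at once. -/
theorem eval_transferForm_mul (x : Fin m → ℂ) (hi₀ : i₀ ≠ 2) {j : Fin (k + 1)}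
    (hα₀ : α i₀ j = 0) (hα : α i j = 0) :
    eval (Fin.cons 1 x : Fin (m + 1) → ℂ) (transferForm α i₀ i j) * contactProd α x i₀ j =
      (∏ u ∈ otherMarkings i₀ i,
        eval (Fin.cons 1 x : Fin (m + 1) → ℂ) (collision i₀ u) ^ Finset.univ.sup (α u)) *
        contactProd α x i j := by
  simp only [transferForm, map_mul, map_prod, map_pow, contactProd]
  simp only [otherMarkings, Finset.prod_filter, ← Finset.prod_mul_distrib]
  refine Finset.prod_congr rfl fun u _ => ?_
  split_ifs with h
  · have h1 : α u j ≤ Finset.univ.sup (α u) := Finset.le_sup (f := α u) (Finset.mem_univ j)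
    obtain ⟨r, hr⟩ := Nat.exists_eq_add_of_le h1
    rw [eval_collision x i h.1, eval_collision x i₀ h.1, hr, Nat.add_sub_cancel_left, pow_add]
    ring
  -- For the omitted markings the two sides agree: `i` and `i₀` enter with exponent zero, and `[1 :
  -- 0]` gives a power of -1 on both sides.
  · rw [one_mul, one_mul, one_mul]
    by_cases hui : u = i
    · rw [hui, hα, pow_zero, pow_zero]
    by_cases hui₀ : u = i₀
    · rw [hui₀, hα₀, pow_zero, pow_zero]
    have hu2 : u = 2 := by
      by_contra hu2
      exact h ⟨hu2, hui, hui₀⟩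
    subst hu2
    rw [planeDet_two hi₀, planeDet_two (Ne.symm hui)]

end Transfer

theorem mk_mem_hyperplane_iff {μ b : Fin (k + 1) → ℂ} (hb : b ≠ 0) :
    Projectivization.mk ℂ b hb ∈ hyperplane μ ↔ ∑ j, μ j * b j = 0 := by
  obtain ⟨a, ha, har⟩ := exists_rep_mk_eq_smul hb
  have h : ∑ j, μ j * (a • b) j = a * ∑ j, μ j * b j := by
    rw [Finset.mul_sum]
    exact Finset.sum_congr rfl fun j _ => by simp only [Pi.smul_apply, smul_eq_mul]; ring
  change ∑ j, μ j * (Projectivization.mk ℂ b hb).rep j = 0 ↔ _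
  rw [har, h, mul_eq_zero, or_iff_right ha]

/-- The point of `ℙ^m × ℙ^k` with affine coordinates `x` in the first factor. -/
noncomputable def affinePoint (x : Fin m → ℂ) (y : Fin (k + 1) → ℂ) (hy : ∀ j, y j ≠ 0) :
    BiProj m k :=
  biPoint (Fin.cons 1 x) y (fun h => one_ne_zero (congrFun h 0)) fun h => hy 0 (congrFun h 0)

section Preimage

variable {α : Fin (m + 3) → Fin (k + 1) → ℕ} {i₀ i : Fin (m + 3)}

/-- Rewrites the hyperplane condition at `i` in terms of the value `c j * contactProd α x i₀ j` at
`i₀`. Coordinates with `α i j ≠ 0` drop out, and the common factor `K` is nonzero for distinct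
markings. -/
theorem sum_eq_zero_iff_transferForm {x : Fin m → ℂ} (hx : Distinct x) (hi₀ : i₀ ≠ 2)
    (hα₀ : ∀ j, α i₀ j = 0) (μ c : Fin (k + 1) → ℂ) :
    ∑ j, μ j * (c j * contactProd α x i j) = 0 ↔
      ∑ j ∈ Finset.univ.filter (fun j => α i j = 0), μ j * (c j * contactProd α x i₀ j) *
        eval (Fin.cons 1 x : Fin (m + 1) → ℂ) (transferForm α i₀ i j) = 0 := by
  set K := ∏ u ∈ otherMarkings i₀ i,
    eval (Fin.cons 1 x : Fin (m + 1) → ℂ) (collision i₀ u) ^ Finset.univ.sup (α u) with hK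
  have hK0 : K ≠ 0 := Finset.prod_ne_zero_iff.2 fun u hu => pow_ne_zero _
    (eval_collision_ne_zero hx (Finset.mem_filter.1 hu).2.1 (Finset.mem_filter.1 hu).2.2.2)
  have h : ∑ j ∈ Finset.univ.filter (fun j => α i j = 0), μ j * (c j * contactProd α x i₀ j) *
      eval (Fin.cons 1 x : Fin (m + 1) → ℂ) (transferForm α i₀ i j) =
      K * ∑ j, μ j * (c j * contactProd α x i j) := by
    rw [Finset.sum_filter, Finset.mul_sum]
    refine Finset.sum_congr rfl fun j _ => ?_
    split_ifs with hj
    · linear_combination μ j * c j * eval_transferForm_mul α x hi₀ (hα₀ j) hj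
    · rw [contactProd_eq_zero α hj]
      ring
  rw [h, mul_eq_zero, or_iff_right hK0]

theorem evPreimage_subset (hi₀ : i₀ ≠ 2) (hα₀ : ∀ j, α i₀ j = 0) {μ : Fin (k + 1) → ℂ}
    {z : BiProj m k} (hz : z ∈ evPreimage α i₀ i (hyperplane μ)) :
    ∃ x y hy, Distinct x ∧ z = affinePoint x y hy ∧
      ∑ j ∈ Finset.univ.filter (fun j => α i j = 0), μ j * y j *
        eval (Fin.cons 1 x : Fin (m + 1) → ℂ) (transferForm α i₀ i j) = 0 := by
  obtain ⟨f, hf, rfl⟩ := hz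
  obtain ⟨c, hc, hform⟩ := f.exists_form_eq
  have hx := f.distinct_coord
  refine ⟨f.coord, fun j => c j * contactProd α f.coord i₀ j,
    fun j => mul_ne_zero (hc j) (contactProd_ne_zero α hx (hα₀ j)), hx, ?_, ?_⟩
  · obtain ⟨h, hev⟩ := f.exists_ev_eq i₀ (f.marking_eq i₀)
    simp only [f.eval_form hform] at hev
    rw [LogMap.embed, affinePoint, biPoint, f.fgt_eq f.marking_eq, hev]
  · obtain ⟨h, hev⟩ := f.exists_ev_eq i (f.marking_eq i)
    change f.ev i ∈ hyperplane μ at hf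
    rw [hev, mk_mem_hyperplane_iff] at hf
    simp only [f.eval_form hform] at hf
    exact (sum_eq_zero_iff_transferForm hx hi₀ hα₀ μ c).1 hf

theorem affinePoint_mem_evPreimage {d : ℕ} (hbal : ∀ j, ∑ i, α i j = d)
    (htan : ∀ i, ∃ j, α i j = 0) (hi₀ : i₀ ≠ 2) (hα₀ : ∀ j, α i₀ j = 0) {μ : Fin (k + 1) → ℂ}
    {x : Fin m → ℂ} (hx : Distinct x) {y : Fin (k + 1) → ℂ} (hy : ∀ j, y j ≠ 0)
    (h : ∑ j ∈ Finset.univ.filter (fun j => α i j = 0), μ j * y j *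
        eval (Fin.cons 1 x : Fin (m + 1) → ℂ) (transferForm α i₀ i j) = 0) :
    affinePoint x y hy ∈ evPreimage α i₀ i (hyperplane μ) := by
  have hP : ∀ j, contactProd α x i₀ j ≠ 0 := fun j => contactProd_ne_zero α hx (hα₀ j)
  -- These are the scalars for which the resulting map takes the value `y` at `i₀`.
  have hc : ∀ j, y j / contactProd α x i₀ j ≠ 0 := fun j => div_ne_zero (hy j) (hP j)
  have hyc : ∀ j, y j / contactProd α x i₀ j * contactProd α x i₀ j = y j := fun j =>
    div_mul_cancel₀ _ (hP j)
  let f : LogMap α := LogMap.ofCoord hbal htan hx hc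
  have hform : ∀ j, f.form j = C (y j / contactProd α x i₀ j) *
    ∏ u, lineForm (stdPoint x u) ^ α u j := fun j => rfl
  refine ⟨f, ?_, ?_⟩
  · obtain ⟨h0, hev⟩ := f.exists_ev_eq (x := x) i rfl
    change f.ev i ∈ hyperplane μ
    rw [hev, mk_mem_hyperplane_iff]
    simp only [f.eval_form hform]
    rw [sum_eq_zero_iff_transferForm hx hi₀ hα₀]
    simpa only [hyc] using h
  · obtain ⟨h0, hev⟩ := f.exists_ev_eq (x := x) i₀ rfl
    simp only [f.eval_form hform, hyc] at hev
    rw [LogMap.embed, affinePoint, biPoint, f.fgt_eq (x := x) fun v => rfl, hev]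

end Preimage

/-! ### The open image of the moduli space -/

/-- A form that vanishes at the points of `ℙ^m × ℙ^k` where two markings collide or a coordinate of
the second factor vanishes. -/
noncomputable def boundaryForm (m k : ℕ) : BiPoly m k :=
  -- The factor `X 0` excludes the points at infinity of the first factor, so that `X 0` can be
  -- normalized to 1.
  rename Sum.inl (X 0 * ∏ w : Fin (m + 3) × Fin (m + 3),
    if w.1 ≠ w.2 ∧ w.1 ≠ 2 ∧ w.2 ≠ 2 then collision w.2 w.1 else 1) * ∏ j, X (Sum.inr j)

theorem exists_isBihomogeneous_boundaryForm (m k : ℕ) :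
    ∃ a b, IsBihomogeneous (boundaryForm m k) a b := by
  have h1 : (∏ w : Fin (m + 3) × Fin (m + 3),
      if w.1 ≠ w.2 ∧ w.1 ≠ 2 ∧ w.2 ≠ 2 then collision w.2 w.1 else 1 :
        MvPolynomial (Fin (m + 1)) ℂ).IsHomogeneous (∑ w : Fin (m + 3) × Fin (m + 3),
      if w.1 ≠ w.2 ∧ w.1 ≠ 2 ∧ w.2 ≠ 2 then 1 else 0) := by
    refine IsHomogeneous.prod _ _ _ fun w _ => ?_
    split_ifs
    · exact isHomogeneous_collision _ _
    · exact isHomogeneous_one _ _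
  have h2 : IsWeightedHomogeneous _ (∏ j, X (Sum.inr j) : BiPoly m k) _ :=
    IsWeightedHomogeneous.prod Finset.univ _ _ fun j _ => isBihomogeneous_inr j
  obtain ⟨a, b, h3⟩ : ∃ a b, IsBihomogeneous (∏ j, X (Sum.inr j) : BiPoly m k) a b := ⟨_, _, h2⟩
  exact ⟨_, _, (isBihomogeneous_rename_inl ((isHomogeneous_X ℂ 0).mul h1)).mul h3⟩

theorem eval_boundaryForm_affine {x : Fin m → ℂ} {y : Fin (k + 1) → ℂ} :
    eval (Sum.elim (Fin.cons 1 x : Fin (m + 1) → ℂ) y) (boundaryForm m k) ≠ 0 ↔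
      Distinct x ∧ ∀ j, y j ≠ 0 := by
  have h : eval (Sum.elim (Fin.cons 1 x : Fin (m + 1) → ℂ) y) (boundaryForm m k) =
      (∏ w : Fin (m + 3) × Fin (m + 3), if w.1 ≠ w.2 ∧ w.1 ≠ 2 ∧ w.2 ≠ 2 then
        eval (Fin.cons 1 x : Fin (m + 1) → ℂ) (collision w.2 w.1) else 1) * ∏ j, y j := by
    simp only [boundaryForm, map_mul, eval_rename, Sum.elim_comp_inl, map_prod, eval_X,
      Fin.cons_zero, one_mul, Sum.elim_inr, apply_ite (eval _), map_one]
  rw [h, mul_ne_zero_iff, Finset.prod_ne_zero_iff, Finset.prod_ne_zero_iff]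
  constructor
  · rintro ⟨h1, h2⟩
    refine ⟨distinct_of_forall_collision fun u v huv hu hv => ?_, fun j => h2 j (Finset.mem_univ j)⟩
    have h3 := h1 (u, v) (Finset.mem_univ _)
    rwa [if_pos ⟨huv, hu, hv⟩] at h3
  · rintro ⟨h1, h2⟩
    refine ⟨fun w _ => ?_, fun j _ => h2 j⟩
    split_ifs with hw
    · exact eval_collision_ne_zero h1 hw.2.1 hw.1
    · exact one_ne_zero

theorem exists_affinePoint_eq {z : BiProj m k} (hz : z ∉ zeroLocus (boundaryForm m k)) :
    ∃ x y hy, Distinct x ∧ z = affinePoint x y hy := by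
  obtain ⟨a, b, hB⟩ := exists_isBihomogeneous_boundaryForm m k
  have h0 : z.1.rep 0 ≠ 0 := by
    intro h
    refine hz ?_
    change eval (Sum.elim z.1.rep z.2.rep) (boundaryForm m k) = 0
    simp [boundaryForm, eval_rename, h]
  have hcons : (Fin.cons 1 fun u => z.1.rep u.succ / z.1.rep 0 : Fin (m + 1) → ℂ) ≠ 0 :=
    fun h => one_ne_zero (congrFun h 0)
  have hz' : z = biPoint (Fin.cons 1 fun u => z.1.rep u.succ / z.1.rep 0) z.2.rep hcons
      z.2.rep_nonzero := by
    refine Prod.ext ?_ (Projectivization.mk_rep _).symm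
    nth_rewrite 1 [← Projectivization.mk_rep z.1]
    rw [biPoint, Projectivization.mk_eq_mk_iff']
    refine ⟨z.1.rep 0, ?_⟩
    ext u
    refine Fin.cases ?_ (fun u => ?_) u
    · simp
    · simp [mul_div_cancel₀ _ h0]
  rw [hz', biPoint_mem_zeroLocus hB] at hz
  obtain ⟨hx, hy⟩ := eval_boundaryForm_affine.1 hz
  exact ⟨_, z.2.rep, hy, hx, hz'⟩

theorem exists_sum_eq_zero {ι : Type*} {J : Finset ι} {j₁ j₂ : ι} (h₁ : j₁ ∈ J) (h₂ : j₂ ∈ J)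
    (hne : j₁ ≠ j₂) {c : ι → ℂ} (hc : ∀ j ∈ J, c j ≠ 0) :
    ∃ y : ι → ℂ, (∀ j, y j ≠ 0) ∧ ∑ j ∈ J, y j * c j = 0 := by
  classical
  have hcard : ((J.erase j₁).card : ℂ) ≠ 0 :=
    Nat.cast_ne_zero.2 (Finset.card_ne_zero_of_mem (Finset.mem_erase.2 ⟨hne.symm, h₂⟩))
  -- Each index of `J` other than `j₁` contributes 1, and `j₁` cancels their number, which is
  -- nonzero thanks to `j₂`.
  refine ⟨fun j => if j ∈ J then (if j = j₁ then -((J.erase j₁).card : ℂ) else 1) / c j else 1,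
    fun j => ?_, ?_⟩
  · dsimp only
    split_ifs with hj hj1
    · exact div_ne_zero (neg_ne_zero.2 hcard) (hc j hj)
    · exact div_ne_zero one_ne_zero (hc j hj)
    · exact one_ne_zero
  · have h : ∀ j ∈ J, (if j ∈ J then (if j = j₁ then -((J.erase j₁).card : ℂ) else 1) / c j else 1) *
        c j = if j = j₁ then -((J.erase j₁).card : ℂ) else 1 := fun j hj => by
      rw [if_pos hj, div_mul_cancel₀ _ (hc j hj)]
    rw [Finset.sum_congr rfl h, ← Finset.add_sum_erase _ _ h₁, if_pos rfl,
      Finset.sum_congr rfl fun j hj => if_neg (Finset.ne_of_mem_erase hj)]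
    simp

end TangencyBound

/-! ### The class of the closure -/

open TangencyBound
theorem proposition3p4 (m k d : ℕ) (α : Fin (m + 3) → Fin (k + 1) → ℕ)
    -- balancing: the maps have degree `d`
    (hbal : ∀ j, ∑ i, α i j = d)
    -- no marking is tangent to all the coordinate hyperplanes
    (htan : ∀ i, ∃ j, α i j = 0)
    -- the fixed marking without tangencies is one of the fourth, fifth, … markings
    (i₀ : Fin (m + 3)) (hi₀ : 3 ≤ (i₀ : ℕ)) (hα₀ : ∀ j, α i₀ j = 0)
    (i : Fin (m + 3)) (hi : i ≠ i₀)
    -- the `i`-th marking is not mapped to a torus-fixed point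
    (hfix : ∃ j j', j ≠ j' ∧ α i j = 0 ∧ α i j' = 0) :
    ∃ χ : ℤ, χ ≤ ((∑ u, Finset.univ.sup (α u) : ℕ) : ℤ) ∧
      -- for all hyperplanes in a nonempty Zariski-open subset of the dual projective space
      ∃ (G : MvPolynomial (Fin (k + 1)) ℂ) (e : ℕ), G.IsHomogeneous e ∧ G ≠ 0 ∧
        ∀ μ : Fin (k + 1) → ℂ, μ ≠ 0 → MvPolynomial.eval μ G ≠ 0 →
          IsDivisorial (closure (evPreimage α i₀ i (hyperplane μ))) ∧
          divisorClass (closure (evPreimage α i₀ i (hyperplane μ))) =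
            χ • classH1 m k + classH2 m k := by
  have hm : 1 ≤ m := by have := i₀.isLt; omega
  have hi₀2 : i₀ ≠ 2 := by
    rintro rfl
    rw [show ((2 : Fin (m + 3)) : ℕ) = 2 from Nat.mod_eq_of_lt (show 2 < m + 3 by omega)] at hi₀
    omega
  obtain ⟨j₁, j₂, hne, hj₁, hj₂⟩ := hfix
  have hk : 1 ≤ k := by
    by_contra h
    obtain rfl : k = 0 := by omega
    exact hne (Subsingleton.elim (α := Fin 1) _ _)
  set J := Finset.univ.filter (fun j => α i j = 0) with hJ
  have hj₁J : j₁ ∈ J := by simp [hJ, hj₁]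
  have hj₂J : j₂ ∈ J := by simp [hJ, hj₂]
  obtain ⟨e, he, g, Q, hQg, hQ, hcop⟩ := exists_isHomogeneous_coprime ⟨j₁, hj₁J⟩ _
    (transferForm α i₀ i) (fun j _ => transferForm_ne_zero α j)
    (fun j _ => isHomogeneous_transferForm α j)
    fun j _ p => isHomogeneous_of_irreducible_dvd_transferForm α j
  have hQ0 : ∀ j ∈ J, Q j ≠ 0 := fun j hj h =>
    transferForm_ne_zero (i₀ := i₀) (i := i) α j (by rw [hQg j hj, h, mul_zero])
  -- The removed factor `g` divides a transfer form, so it has no zero where the markings are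
  -- distinct; removing it does not change the equation there.
  have hsplit : ∀ x : Fin m → ℂ, Distinct x →
      eval (Fin.cons 1 x : Fin (m + 1) → ℂ) g ≠ 0 ∧
        ∀ j ∈ J, eval (Fin.cons 1 x : Fin (m + 1) → ℂ) (Q j) ≠ 0 := by
    intro x hx
    have h : ∀ j ∈ J, eval (Fin.cons 1 x : Fin (m + 1) → ℂ) g *
        eval (Fin.cons 1 x : Fin (m + 1) → ℂ) (Q j) ≠ 0 := fun j hj => by
      rw [← map_mul, ← hQg j hj]
      exact eval_transferForm_ne_zero α hx j
    exact ⟨left_ne_zero_of_mul (h j₁ hj₁J), fun j hj => right_ne_zero_of_mul (h j hj)⟩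
  -- The open condition on the hyperplane is that all its coefficients are nonzero, which keeps
  -- every term of the linear form.
  refine ⟨e, ?_, ∏ j, X j, ∑ _j, 1, IsHomogeneous.prod _ _ _ fun j _ => isHomogeneous_X _ j,
    Finset.prod_ne_zero_iff.2 fun j _ => X_ne_zero j, fun μ _ hμG => ?_⟩
  · exact_mod_cast he.trans (Finset.sum_le_sum_of_subset (Finset.subset_univ _))
  have hμ : ∀ j, μ j ≠ 0 := fun j => by
    simp only [map_prod, eval_X] at hμG
    exact Finset.prod_ne_zero_iff.1 hμG j (Finset.mem_univ j)
  have hF := isBihomogeneous_linearForm (k := k) μ hQ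
  have hFp : Prime (linearForm J μ Q) := prime_linearForm ⟨j₁, hj₁J⟩ hμ hQ0 hcop
  obtain ⟨a, b, hB⟩ := exists_isBihomogeneous_boundaryForm m k
  have hsum : ∀ (x : Fin m → ℂ) (y : Fin (k + 1) → ℂ) (hy : ∀ j, y j ≠ 0), Distinct x →
      (affinePoint x y hy ∈ zeroLocus (linearForm J μ Q) ↔ ∑ j ∈ J, μ j * y j *
        eval (Fin.cons 1 x : Fin (m + 1) → ℂ) (transferForm α i₀ i j) = 0) := by
    intro x y hy hx
    rw [affinePoint, biPoint_mem_zeroLocus hF, eval_linearForm]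
    have h : ∑ j ∈ J, μ j * y j *
        eval (Fin.cons 1 x : Fin (m + 1) → ℂ) (transferForm α i₀ i j) =
        eval (Fin.cons 1 x : Fin (m + 1) → ℂ) g * ∑ j ∈ J, μ j * y j *
          eval (Fin.cons 1 x : Fin (m + 1) → ℂ) (Q j) := by
      rw [Finset.mul_sum]
      refine Finset.sum_congr rfl fun j hj => ?_
      rw [hQg j hj, map_mul]
      ring
    rw [h, mul_eq_zero, or_iff_right (hsplit x hx).1]
  have hpre : evPreimage α i₀ i (hyperplane μ) =
      zeroLocus (linearForm J μ Q) ∩ (zeroLocus (boundaryForm m k))ᶜ := by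
    ext z
    constructor
    · intro hz
      obtain ⟨x, y, hy, hx, rfl, h⟩ := evPreimage_subset hi₀2 hα₀ hz
      refine ⟨(hsum x y hy hx).2 h, ?_⟩
      rw [Set.mem_compl_iff, affinePoint, biPoint_mem_zeroLocus hB]
      exact eval_boundaryForm_affine.2 ⟨hx, hy⟩
    · rintro ⟨hzF, hzB⟩
      obtain ⟨x, y, hy, hx, rfl⟩ := exists_affinePoint_eq hzB
      exact affinePoint_mem_evPreimage hbal htan hi₀2 hα₀ hx hy ((hsum x y hy hx).1 hzF)
  have hclosure : closure (evPreimage α i₀ i (hyperplane μ)) = zeroLocus (linearForm J μ Q) := by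
    apply subset_antisymm
    · rw [hpre]
      exact closure_minimal Set.inter_subset_left (isClosed_zeroLocus hF)
    · rw [hpre]
      -- A nonempty open part of an irreducible set is dense in it, so a single point of the zero
      -- locus off the boundary suffices.
      refine subset_closure_inter_of_isPreirreducible_of_isOpen
        (isIrreducible_zeroLocus hm hk hF hFp).2 (isClosed_zeroLocus hB).isOpen_compl ?_
      -- For fixed distinct markings the equation is linear in `y` with at least two terms, all with
      -- nonzero coefficients, so it has a solution with no zero coordinate.
      obtain ⟨x, hx⟩ := exists_distinct m
      obtain ⟨y, hy, hy0⟩ := exists_sum_eq_zero hj₁J hj₂J hne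
        (c := fun j => μ j * eval (Fin.cons 1 x : Fin (m + 1) → ℂ) (transferForm α i₀ i j))
        fun j _ => mul_ne_zero (hμ j) (eval_transferForm_ne_zero α hx j)
      refine ⟨affinePoint x y hy, (hsum x y hy hx).2 ?_, ?_⟩
      · rw [← hy0]
        exact Finset.sum_congr rfl fun j _ => by ring
      · rw [Set.mem_compl_iff, affinePoint, biPoint_mem_zeroLocus hB]
        exact eval_boundaryForm_affine.2 ⟨hx, hy⟩
  rw [hclosure]
  refine ⟨isDivisorial_zeroLocus hm hk hF hFp, ?_⟩
  rw [divisorClass_zeroLocus_eq hm hk hF hFp, Nat.cast_one, one_smul]
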